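/- Let $E$ be a finite set with $n$ elements. A sign vector on $E$ is an $X\in\{+,-,0\}^E$; write $X^+,X^-,X^0$ for the sets of $e\in E$ with $X_e=+$, $X_e=-$, $X_e=0$ respectively, $\underline X=E\setminus X^0$ for the support, $-X$ for the vector with all signs reversed, and $S(X,Y)=\{e\in E: \{X_e,Y_e\}=\{+,-\}\}$ for the separator of $X$ and $Y$. For an integer $r\ge 0$ and a set $\mathcal S$ of sign vectors on $E$ consider the following axioms. (C1) Every $X\in\mathcal S$ has support of size $n-r+1$. (C2) For every $I\subseteq E$ of size $n-r+1$ there are exactly two $X,Y\in\mathcal S$ with support $I$; moreover $Y=-X$. (C3) For all $X,Y\in\mathcal S$ with $X\neq -Y$ and every $e\in S(X,Y)$ there is $Z\in\mathcal S$ with $Z_e=0$ and $Z_f\in\{X_f,Y_f,0\}$ for every $f\in E\setminus\{e\}$. The sets satisfying (C1), (C2) and (C3) are the sets of cocircuits of uniform oriented matroids of rank $r$ on $E$. A sign labeling of a simple graph $G=(V,\mathcal E)$ is a bijection $L$ from $V$ onto a set $\mathcal S$ of sign vectors satisfying (C1) and (C2), such that, for all $v,w\in V$, $\{v,w\}\in\mathcal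 E$ if and only if $|L(v)^0\,\Delta\, L(w)^0|=2$ and $S(L(v),L(w))=\emptyset$. It is an OM-labeling if $\mathcal S$ also satisfies (C3). A path in $G$ from $v$ to $w$ is crabbed if every vertex $u$ on it satisfies $L(u)^+\subseteq L(v)^+\cup L(w)^+$ and $L(u)^-\subseteq L(v)^-\cup L(w)^-$. **Theorem.** Let $L$ be a sign labeling of $G$. Then the following are equivalent: 1. $L$ is an OM-labeling. 2. For all distinct $v,w\in V$, the maximum number of distinct crabbed $v,w$-paths that pairwise share no vertex other than $v$ and $w$ is exactly $|L(v)^0\setminus L(w)^0|$. 3. For all $v,w\in V$ with $L(v)^0\neq L(w)^0$ there exists a crabbed $v,w$-path. -/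

import Mathlib

namespace CocircuitGraph

/-- Sign vectors on the ground set `E`: elements of `{+,-,0}^E`. -/
abbrev SignVec (E : Type*) := E → SignType

section Basic

variable {E : Type*} [Fintype E]

/-- `X⁺`: the elements on which `X` is positive. -/
def posPart (X : SignVec E) : Finset E := Finset.univ.filter fun e => X e = 1

/-- `X⁻`: the elements on which `X` is negative. -/
def negPart (X : SignVec E) : Finset E := Finset.univ.filter fun e => X e = -1

/-- `X⁰`: the zero-support of `X`. -/
def zeroSupp (X : SignVec E) : Finset E := Finset.univ.filter fun e => X e = 0

/-- The support of `X`. -/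
def supp (X : SignVec E) : Finset E := Finset.univ.filter fun e => X e ≠ 0

/-- The separator `S(X,Y)`: the elements on which `X` and `Y` have opposite nonzero signs. -/
def separator (X Y : SignVec E) : Finset E :=
  Finset.univ.filter fun e => (X e = 1 ∧ Y e = -1) ∨ (X e = -1 ∧ Y e = 1)

/-- (C1) for rank `r`: every member of `C` has support of size `n - r + 1`, with `n = |E|`
(the equation is written without subtraction). -/
def AxiomC1 (r : ℕ) (C : Set (SignVec E)) : Prop :=
  ∀ X ∈ C, (supp X).card + r = Fintype.card E + 1

/-- (C2) for rank `r`: for every `I ⊆ E` of size `n - r + 1` there are exactly two members of `C`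
with support `I`, and they are negatives of each other. -/
def AxiomC2 (r : ℕ) (C : Set (SignVec E)) : Prop :=
  ∀ I : Finset E, I.card + r = Fintype.card E + 1 →
    ∃ X Y : SignVec E, X ≠ Y ∧ -X = Y ∧ {Z | Z ∈ C ∧ supp Z = I} = {X, Y}

/-- (C3), cocircuit elimination: for `X, Y` in `C` with `X ≠ -Y` and `e ∈ S(X,Y)` there is
`Z` in `C` with `Z_e = 0` and `Z_f ∈ {X_f, Y_f, 0}` for all `f ≠ e`. -/
def AxiomC3 (C : Set (SignVec E)) : Prop :=
  ∀ X ∈ C, ∀ Y ∈ C, X ≠ -Y → ∀ e ∈ separator X Y,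
    ∃ Z ∈ C, Z e = 0 ∧ ∀ f, f ≠ e → Z f = X f ∨ Z f = Y f ∨ Z f = 0

/-- `C` is the set of cocircuits of a uniform oriented matroid of rank `r` on `E`. -/
structure IsUniformOM (r : ℕ) (C : Set (SignVec E)) : Prop where
  c1 : AxiomC1 r C
  c2 : AxiomC2 r C
  c3 : AxiomC3 C

end Basic

section Labelings

variable {E V : Type*} [Fintype E] [DecidableEq E]

/-- `L` is a sign labeling of `G` with rank parameter `r`: a bijection from the vertices onto a set
of sign vectors (its range) satisfying (C1) and (C2), such that two vertices are adjacent if and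
only if `|L(v)⁰ Δ L(w)⁰| = 2` and `S(L(v),L(w)) = ∅`. -/
structure IsSignLabeling (G : SimpleGraph V) (r : ℕ) (L : V → SignVec E) : Prop where
  injective : Function.Injective L
  c1 : AxiomC1 r (Set.range L)
  c2 : AxiomC2 r (Set.range L)
  adj_iff : ∀ v w, G.Adj v w ↔
    (symmDiff (zeroSupp (L v)) (zeroSupp (L w))).card = 2 ∧ separator (L v) (L w) = ∅

/-- `L` is an OM-labeling of `G`: a sign labeling whose set of labels is the set of cocircuits of a
uniform oriented matroid. -/
def IsOMLabeling (G : SimpleGraph V) (r : ℕ) (L : V → SignVec E) : Prop :=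
  IsSignLabeling G r L ∧ IsUniformOM r (Set.range L)

/-- A walk is `(X,Y)`-crabbed if `L(u)⁺ ⊆ X⁺ ∪ Y⁺` and `L(u)⁻ ⊆ X⁻ ∪ Y⁻` for each of its
vertices `u`. -/
def CrabbedFor {G : SimpleGraph V} (L : V → SignVec E) (X Y : SignVec E) {v w : V}
    (p : G.Walk v w) : Prop :=
  ∀ u ∈ p.support,
    posPart (L u) ⊆ posPart X ∪ posPart Y ∧ negPart (L u) ⊆ negPart X ∪ negPart Y

/-- A `(v,w)`-path is crabbed if it is `(L(v),L(w))`-crabbed. -/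
def Crabbed {G : SimpleGraph V} (L : V → SignVec E) {v w : V} (p : G.Path v w) : Prop :=
  CrabbedFor L (L v) (L w) p.1

/-- There are `k` distinct crabbed `(v,w)`-paths that pairwise share no vertices other than the
ends `v` and `w`. -/
def HasDisjointCrabbedPaths (G : SimpleGraph V) (L : V → SignVec E) (v w : V) (k : ℕ) : Prop :=
  ∃ P : Fin k → G.Path v w, Function.Injective P ∧ (∀ i, Crabbed L (P i)) ∧
    ∀ i j, i ≠ j → ∀ u, u ∈ (P i).1.support → u ∈ (P j).1.support → u = v ∨ u = w

end Labelings

end CocircuitGraph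

/-! ### Signs, exchanges of finite sets, and compatibility at an element. -/

namespace CocircuitGraph

/-! The guiding picture is an arrangement of pseudo-hyperplanes in general position, one for each
element of `E`. Labels are its vertices; edges join unseparated vertices that lie on the same
hyperplanes except for one exchange. The vectors crabbed for `v` and `w` form a region inside the
flat `L(v)⁰ ∩ L(w)⁰`, of dimension `k = |L(v)⁰ \ L(w)⁰|`.

From 3 to 1: neighbours are never separated, so along a crabbed path a sign at `e` can change only
through `0`. The first vertex at which the sign changes is the vector required by (C3). From 2 to 3:
distinct zero supports have the same size, so `k > 0`.

From 1 to 2, upper bound: the first step of a crabbed path frees one element of `L(v)⁰ \ L(w)⁰`,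
with the sign of `L(w)`. By `neighbor_unique` that element determines the neighbour, so disjoint
paths free distinct elements.

From 1 to 2, lower bound: Menger's theorem (`linked_of_forall_exists_walk`) reduces it to
`reach_region`: a region of dimension `k` stays connected when fewer than `k` vertices are removed.
This goes by induction on the dimension. Either one hyperplane meeting the region contains all
removed vertices, or every facet loses fewer vertices than the whole and is connected by induction;
adjacent facets are then chained along a path that ignores the removal. The basic input is
`reach_openRegion`: the vertices on one open side of a hyperplane `f` are connected. There, elements
of `E` are deleted one at a time, and a path of the deletion is repaired where it crosses the
restored hyperplane. Deletion is modelled by the parameter `F`, the surviving elements, so that the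
ground set never changes. -/

lemma sign_eq_neg_of_ne {s t : SignType} (hs : s ≠ 0) (ht : t ≠ 0) (h : s ≠ t) : t = -s := by
  revert s t; decide

lemma sign_ne_neg_self {s : SignType} (hs : s ≠ 0) : s ≠ -s := by
  revert s; decide

lemma card_symmDiff_exchange {E : Type*} [DecidableEq E] {I : Finset E} {a b : E} (ha : a ∈ I) (hb : b ∉ I) :
    (symmDiff I (insert b (I.erase a))).card = 2 := by
  have hab : a ≠ b := fun h => hb (h ▸ ha)
  have : symmDiff I (insert b (I.erase a)) = {a, b} := by
    ext x
    simp only [Finset.mem_symmDiff, Finset.mem_insert, Finset.mem_erase, Finset.mem_singleton]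
    by_cases hxa : x = a
    · subst hxa; simp [ha, hab]
    · by_cases hxb : x = b
      · subst hxb; simp [hb]
      · simp [hxa, hxb]
  rw [this, Finset.card_pair hab]

lemma exists_exchange_of_card_symmDiff {E : Type*} [DecidableEq E] {I J : Finset E} (hIJ : I.card = J.card)
    (h : (symmDiff I J).card = 2) :
    ∃ a ∈ I, a ∉ J ∧ ∃ b ∈ J, b ∉ I ∧ J = insert b (I.erase a) := by
  have h1 : (I \ J).card = (J \ I).card := by
    rw [Finset.card_sdiff_comm hIJ]
  have h2 : (I \ J).card + (J \ I).card = 2 := by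
    rw [← h, symmDiff_def, Finset.sup_eq_union, Finset.card_union_of_disjoint]
    exact disjoint_sdiff_sdiff
  obtain ⟨a, ha⟩ := Finset.card_eq_one.1 (show (I \ J).card = 1 by omega)
  obtain ⟨b, hb⟩ := Finset.card_eq_one.1 (show (J \ I).card = 1 by omega)
  have ha' : ∀ x, (x ∈ I ∧ x ∉ J) ↔ x = a := fun x => by
    rw [← Finset.mem_sdiff, ha, Finset.mem_singleton]
  have hb' : ∀ x, (x ∈ J ∧ x ∉ I) ↔ x = b := fun x => by
    rw [← Finset.mem_sdiff, hb, Finset.mem_singleton]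
  refine ⟨a, ((ha' a).2 rfl).1, ((ha' a).2 rfl).2, b, ((hb' b).2 rfl).1, ((hb' b).2 rfl).2, ?_⟩
  ext x
  have := ha' x
  have := hb' x
  simp only [Finset.mem_insert, Finset.mem_erase]
  tauto

/-- The values of `X` and `Y` at `e` are not opposite. -/
def CompatAt {E : Type*} (X Y : SignVec E) (e : E) : Prop := X e = 0 ∨ Y e = 0 ∨ X e = Y e

lemma CompatAt.symm {E : Type*} {X Y : SignVec E} {e : E} (h : CompatAt X Y e) : CompatAt Y X e := by
  rcases h with h | h | h
  · exact Or.inr (Or.inl h)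
  · exact Or.inl h
  · exact Or.inr (Or.inr h.symm)

/-! ### Consequences of the axioms, and neighbours in a deletion. -/

section Axioms

variable {E : Type*} [Fintype E]


@[simp] lemma mem_zeroSupp {X : SignVec E} {e : E} : e ∈ zeroSupp X ↔ X e = 0 := by
  simp [zeroSupp]

@[simp] lemma zeroSupp_neg (X : SignVec E) : zeroSupp (-X) = zeroSupp X := by
  ext e; simp

lemma mem_separator_iff {X Y : SignVec E} {e : E} :
    e ∈ separator X Y ↔ ¬ CompatAt X Y e := by
  simp only [separator, Finset.mem_filter, Finset.mem_univ, true_and, CompatAt]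
  generalize X e = s
  generalize Y e = t
  revert s t; decide

lemma separator_eq_empty_iff {X Y : SignVec E} :
    separator X Y = ∅ ↔ ∀ e, CompatAt X Y e := by
  simp [Finset.eq_empty_iff_forall_notMem, mem_separator_iff]

lemma card_supp_add_card_zeroSupp (X : SignVec E) :
    (supp X).card + (zeroSupp X).card = Fintype.card E := by
  rw [add_comm]
  exact Finset.card_filter_add_card_filter_not (s := Finset.univ) (fun e => X e = 0)

lemma card_zeroSupp_of_axiomC1 {r : ℕ} {C : Set (SignVec E)} (h : AxiomC1 r C) {X : SignVec E}
    (hX : X ∈ C) : (zeroSupp X).card + 1 = r := by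
  have h1 := h X hX
  have h2 := card_supp_add_card_zeroSupp X
  omega

lemma supp_eq_iff_zeroSupp_eq {X Y : SignVec E} :
    supp X = supp Y ↔ zeroSupp X = zeroSupp Y := by
  simp only [Finset.ext_iff, mem_zeroSupp, supp, Finset.mem_filter, Finset.mem_univ, true_and,
    ne_eq, not_iff_not]

lemma neg_mem_of_axiomC2 {r : ℕ} {C : Set (SignVec E)} (h1 : AxiomC1 r C) (h2 : AxiomC2 r C)
    {X : SignVec E} (hX : X ∈ C) : -X ∈ C := by
  obtain ⟨P, Q, -, rfl, h⟩ := h2 (supp X) (h1 X hX)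
  have hX' : X ∈ ({P, -P} : Set (SignVec E)) := h ▸ ⟨hX, rfl⟩
  have hP : P ∈ {Z | Z ∈ C ∧ supp Z = supp X} := h ▸ Or.inl rfl
  have hQ : -P ∈ {Z | Z ∈ C ∧ supp Z = supp X} := h ▸ Or.inr rfl
  rcases hX' with rfl | hX'
  · exact hQ.1
  · rw [Set.mem_singleton_iff] at hX'
    rw [hX', neg_neg]
    exact hP.1

lemma eq_or_eq_neg_of_axiomC2 {r : ℕ} {C : Set (SignVec E)} (h1 : AxiomC1 r C)
    (h2 : AxiomC2 r C) {X Y : SignVec E} (hX : X ∈ C) (hY : Y ∈ C)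
    (hXY : zeroSupp X = zeroSupp Y) : Y = X ∨ Y = -X := by
  obtain ⟨P, Q, -, rfl, h⟩ := h2 (supp X) (h1 X hX)
  have hX' : X ∈ ({P, -P} : Set (SignVec E)) := h ▸ ⟨hX, rfl⟩
  have hY' : Y ∈ ({P, -P} : Set (SignVec E)) := h ▸ ⟨hY, supp_eq_iff_zeroSupp_eq.2 hXY.symm⟩
  rcases hX' with rfl | hX' <;> rcases hY' with hY' | hY' <;>
    simp_all

/-- Two vectors are adjacent relative to `F` if their zero supports differ by an exchange and no
element of `F` separates them. -/
def AdjOn [DecidableEq E] (F : Finset E) (X Y : SignVec E) : Prop :=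
  (symmDiff (zeroSupp X) (zeroSupp Y)).card = 2 ∧ ∀ e ∈ F, CompatAt X Y e

lemma AdjOn.symm [DecidableEq E] {F : Finset E} {X Y : SignVec E} (h : AdjOn F X Y) :
    AdjOn F Y X :=
  ⟨by rw [symmDiff_comm]; exact h.1, fun e he => (h.2 e he).symm⟩

namespace IsUniformOM

variable {r : ℕ} {C : Set (SignVec E)}

lemma card_zeroSupp (h : IsUniformOM r C) {X : SignVec E} (hX : X ∈ C) :
    (zeroSupp X).card + 1 = r :=
  card_zeroSupp_of_axiomC1 h.c1 hX

lemma neg_mem (h : IsUniformOM r C) {X : SignVec E} (hX : X ∈ C) : -X ∈ C :=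
  neg_mem_of_axiomC2 h.c1 h.c2 hX

lemma zeroSupp_eq_of_subset (h : IsUniformOM r C) {X : SignVec E} (hX : X ∈ C) {I : Finset E}
    (hI : I.card + 1 = r) (hs : I ⊆ zeroSupp X) : zeroSupp X = I := by
  have := h.card_zeroSupp hX
  exact (Finset.eq_of_subset_of_card_le hs (by omega)).symm

lemma eq_or_eq_neg_of_subset (h : IsUniformOM r C) {X Y : SignVec E} (hX : X ∈ C) (hY : Y ∈ C)
    (hXY : zeroSupp X ⊆ zeroSupp Y) : Y = X ∨ Y = -X :=
  eq_or_eq_neg_of_axiomC2 h.c1 h.c2 hX hY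
    (h.zeroSupp_eq_of_subset hY (h.card_zeroSupp hX) hXY).symm

variable [DecidableEq E]

lemma exists_zeroSupp_eq (h : IsUniformOM r C) {I : Finset E} (hI : I.card + 1 = r) :
    ∃ X ∈ C, zeroSupp X = I := by
  obtain ⟨P, Q, -, -, hPQ⟩ := h.c2 Iᶜ (by
    have := Finset.card_add_card_compl I
    omega)
  have hP : P ∈ {Z | Z ∈ C ∧ supp Z = Iᶜ} := hPQ ▸ Or.inl rfl
  refine ⟨P, hP.1, ?_⟩
  have h2 := hP.2
  ext e
  have := Finset.ext_iff.1 h2 e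
  simp only [supp, Finset.mem_filter, Finset.mem_univ, true_and, Finset.mem_compl] at this
  rw [mem_zeroSupp]
  tauto

/-- Elimination of an element at which two cocircuits are not compatible. -/
lemma elim (h : IsUniformOM r C) {X Y : SignVec E} (hX : X ∈ C) (hY : Y ∈ C) (hXY : X ≠ -Y)
    {e : E} (he : ¬ CompatAt X Y e) :
    ∃ Z ∈ C, Z e = 0 ∧ ∀ f, Z f = X f ∨ Z f = Y f ∨ Z f = 0 := by
  obtain ⟨Z, hZ, hZe, hZf⟩ := h.c3 X hX Y hY hXY e (mem_separator_iff.2 he)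
  refine ⟨Z, hZ, hZe, fun f => ?_⟩
  by_cases hf : f = e
  · subst hf; exact Or.inr (Or.inr hZe)
  · exact hZf f hf

/-- Every cocircuit with zero support in `F` has, for each `a` in its zero support and each sign
`s`, a neighbour relative to `F` that takes the value `s` at `a`. -/
lemma exists_neighbor (h : IsUniformOM r C) {F : Finset E} {X : SignVec E} (hX : X ∈ C)
    {a : E} (ha : X a = 0) {f : E} (hf : f ∈ F) (hXf : X f ≠ 0) {s : SignType} (hs : s ≠ 0) :
    ∃ U ∈ C, ∃ b ∈ F, X b ≠ 0 ∧ zeroSupp U = insert b ((zeroSupp X).erase a) ∧ U a = s ∧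
      ∀ e ∈ F, CompatAt X U e := by
  classical
  have hcard : ∀ b, X b ≠ 0 → (insert b ((zeroSupp X).erase a)).card + 1 = r := by
    intro b hb
    rw [Finset.card_insert_of_notMem (by simp [hb]), Finset.card_erase_of_mem (by simpa using ha)]
    have := h.card_zeroSupp hX
    have : 0 < (zeroSupp X).card := Finset.card_pos.2 ⟨a, by simpa using ha⟩
    omega
  let D : SignVec E → Prop := fun U => U ∈ C ∧ ∃ b ∈ F, X b ≠ 0 ∧
    zeroSupp U = insert b ((zeroSupp X).erase a) ∧ U a = s
  have hD : ∃ U, D U := by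
    obtain ⟨U, hU, hU0⟩ := h.exists_zeroSupp_eq (hcard f hXf)
    have haf : a ≠ f := fun h => hXf (h ▸ ha)
    have hUa : U a ≠ 0 := by
      rw [Ne, ← mem_zeroSupp, hU0]
      simp [haf]
    by_cases hUs : U a = s
    · exact ⟨U, hU, f, hf, hXf, hU0, hUs⟩
    · refine ⟨-U, h.neg_mem hU, f, hf, hXf, by rw [zeroSupp_neg, hU0], ?_⟩
      rw [Pi.neg_apply, sign_eq_neg_of_ne hUa hs hUs]
  -- Among the candidates with the prescribed sign at `a`, take one with fewest conflicts with `X`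
  -- in `F`. Eliminating a conflict `e` between `X` and `U` yields another candidate: it keeps the
  -- zeros `X⁰ \ {a}`, gains `e`, still has sign `s` at `a`, and creates no new conflict.
  obtain ⟨U, hUD, hmin⟩ := exists_minimalFor_of_wellFoundedLT D
    (fun U => (F.filter fun e => ¬ CompatAt X U e).card) hD
  obtain ⟨hU, b, hb, hXb, hU0, hUa⟩ := hUD
  refine ⟨U, hU, b, hb, hXb, hU0, hUa, ?_⟩
  by_contra! hcon
  obtain ⟨e, heF, he⟩ := hcon
  have hXe : X e ≠ 0 := fun h => he (Or.inl h)
  obtain ⟨Z, hZ, hZe, hZf⟩ := h.elim hX hU (fun h => by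
    have := congrFun h a
    rw [Pi.neg_apply, ha, hUa] at this
    exact hs ((by decide : ∀ t : SignType, 0 = -t → t = 0) s this)) he
  have hZ0 : zeroSupp Z = insert e ((zeroSupp X).erase a) := by
    refine h.zeroSupp_eq_of_subset hZ (hcard e hXe) fun x hx => ?_
    rw [Finset.mem_insert] at hx
    rcases hx with rfl | hx
    · simpa using hZe
    · have hx1 : X x = 0 := by simpa using Finset.mem_of_mem_erase hx
      have hx2 : U x = 0 := by
        rw [← mem_zeroSupp, hU0]; exact Finset.mem_insert_of_mem hx
      have := hZf x
      rw [hx1, hx2] at this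
      simpa using this
  have hZa : Z a = s := by
    have hae : a ≠ e := fun h => hXe (h ▸ ha)
    have hne : Z a ≠ 0 := by
      rw [Ne, ← mem_zeroSupp, hZ0]
      simp [hae]
    have := hZf a
    rw [ha, hUa] at this
    tauto
  have hlt : (F.filter fun e => ¬ CompatAt X Z e).card <
      (F.filter fun e => ¬ CompatAt X U e).card := by
    refine Finset.card_lt_card ⟨fun x hx => ?_, fun hsub => ?_⟩
    · rw [Finset.mem_filter] at hx ⊢
      refine ⟨hx.1, fun hc => hx.2 ?_⟩
      unfold CompatAt at hc ⊢
      rcases hZf x with h' | h' | h' <;> rw [h'] <;> tauto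
    · have := hsub (Finset.mem_filter.2 ⟨heF, he⟩)
      rw [Finset.mem_filter] at this
      exact this.2 (Or.inr (Or.inl hZe))
  exact absurd (hmin (j := Z) ⟨hZ, e, heF, hXe, hZ0, hZa⟩ hlt.le) (not_le.2 hlt)

end IsUniformOM

end Axioms

/-! ### Connections inside a deletion, and crossing a hyperplane. -/

section Reachability

variable {E : Type*} [Fintype E] [DecidableEq E]

/-- `Y` can be reached from `X` by steps between vectors that satisfy `P` and are adjacent relative
to `F`. -/
def Reach (F : Finset E) (P : SignVec E → Prop) : SignVec E → SignVec E → Prop :=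
  Relation.ReflTransGen fun U W => P U ∧ P W ∧ AdjOn F U W

lemma Reach.refl {F : Finset E} {P : SignVec E → Prop} (X : SignVec E) : Reach F P X X :=
  Relation.ReflTransGen.refl

lemma Reach.single {F : Finset E} {P : SignVec E → Prop} {X Y : SignVec E} (hX : P X) (hY : P Y)
    (h : AdjOn F X Y) : Reach F P X Y :=
  Relation.ReflTransGen.single ⟨hX, hY, h⟩

lemma Reach.trans {F : Finset E} {P : SignVec E → Prop} {X Y Z : SignVec E}
    (h : Reach F P X Y) (h' : Reach F P Y Z) : Reach F P X Z :=
  Relation.ReflTransGen.trans h h'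

lemma Reach.symm {F : Finset E} {P : SignVec E → Prop} {X Y : SignVec E}
    (h : Reach F P X Y) : Reach F P Y X := by
  induction h with
  | refl => exact Reach.refl X
  | tail _ hs ih => exact (Reach.single hs.2.1 hs.1 hs.2.2.symm).trans ih

lemma Reach.mono {F : Finset E} {P Q : SignVec E → Prop} (hPQ : ∀ U, P U → Q U)
    {X Y : SignVec E} (h : Reach F P X Y) : Reach F Q X Y :=
  Relation.ReflTransGen.mono (fun _ _ hUW => ⟨hPQ _ hUW.1, hPQ _ hUW.2.1, hUW.2.2⟩) _ _ h

lemma adjOn_of_zeroSupp_eq {F : Finset E} {X U : SignVec E} {a b : E} (ha : X a = 0) (hb : X b ≠ 0)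
    (h : zeroSupp U = insert b ((zeroSupp X).erase a)) (hc : ∀ e ∈ F, CompatAt X U e) :
    AdjOn F X U :=
  ⟨by rw [h]; exact card_symmDiff_exchange (by simpa using ha) (by simpa using hb), hc⟩

namespace IsUniformOM

variable {r : ℕ} {C : Set (SignVec E)}

/-- Two cocircuits that are adjacent relative to `F.erase g` but take opposite values at `g` have a
common neighbour relative to `F` that vanishes at `g`. -/
lemma exists_crossing (h : IsUniformOM r C) {F : Finset E} {g : E} {U W : SignVec E} (hU : U ∈ C)
    (hW : W ∈ C) (hUW : AdjOn (F.erase g) U W) (hg : ¬ CompatAt U W g) :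
    ∃ p ∈ C, p g = 0 ∧ zeroSupp p ⊆ insert g (zeroSupp U) ∧
      (∀ f, p f = U f ∨ p f = W f ∨ p f = 0) ∧ AdjOn F U p ∧ AdjOn F p W := by
  have hcU := h.card_zeroSupp hU
  have hcW := h.card_zeroSupp hW
  obtain ⟨a, haU, haW, b, hbW, hbU, hab⟩ :=
    exists_exchange_of_card_symmDiff (by omega : (zeroSupp U).card = (zeroSupp W).card) hUW.1
  obtain ⟨a', ha'W, ha'U, b', hb'U, hb'W, hab'⟩ :=
    exists_exchange_of_card_symmDiff (by omega : (zeroSupp W).card = (zeroSupp U).card) hUW.symm.1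
  have hgU : U g ≠ 0 := fun h => hg (Or.inl h)
  have hgW : W g ≠ 0 := fun h => hg (Or.inr (Or.inl h))
  rw [mem_zeroSupp] at haU haW hbU hbW ha'W ha'U hb'U hb'W
  -- The eliminated vector vanishes at `g` and on `U⁰ ∩ W⁰`, already `r - 1` elements, so these are
  -- all its zeros and it is one exchange away from both `U` and `W`.
  obtain ⟨p, hp, hpg, hpf⟩ := h.elim hU hW (fun hn => by
    rw [hn] at haU
    exact haW ((by decide : ∀ t : SignType, -t = 0 → t = 0) _ haU)) hg
  have hsub : zeroSupp U ∩ zeroSupp W ⊆ zeroSupp p := by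
    intro x hx
    simp only [Finset.mem_inter, mem_zeroSupp] at hx
    have := hpf x
    rw [hx.1, hx.2] at this
    simpa using this
  have key : ∀ {Y Y' : SignVec E} {a b : E}, Y ∈ C → Y a = 0 → Y g ≠ 0 →
      zeroSupp Y' = insert b ((zeroSupp Y).erase a) → zeroSupp Y ∩ zeroSupp Y' ⊆ zeroSupp p →
      zeroSupp p = insert g ((zeroSupp Y).erase a) := by
    intro Y Y' a b hY hYa hYg hYY' hs
    have hcY := h.card_zeroSupp hY
    refine h.zeroSupp_eq_of_subset hp ?_ ?_
    · rw [Finset.card_insert_of_notMem (by simp [hYg]),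
        Finset.card_erase_of_mem (by simpa using hYa)]
      have : 0 < (zeroSupp Y).card := Finset.card_pos.2 ⟨a, by simpa using hYa⟩
      omega
    · intro x hx
      rw [Finset.mem_insert] at hx
      rcases hx with rfl | hx
      · simpa using hpg
      · refine hs (Finset.mem_inter.2 ⟨Finset.mem_of_mem_erase hx, ?_⟩)
        rw [hYY']
        exact Finset.mem_insert_of_mem hx
  have hpU := key hU haU hgU hab hsub
  have hpW := key hW ha'W hgW hab' (by rwa [Finset.inter_comm])
  have hcomp : ∀ e ∈ F, CompatAt U p e ∧ CompatAt W p e := by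
    intro e he
    by_cases heg : e = g
    · subst heg
      exact ⟨Or.inr (Or.inl hpg), Or.inr (Or.inl hpg)⟩
    · have h1 := hUW.2 e (Finset.mem_erase.2 ⟨heg, he⟩)
      have h2 := hpf e
      unfold CompatAt at h1 ⊢
      rcases h2 with h2 | h2 | h2 <;> rw [h2] <;> tauto
  refine ⟨p, hp, hpg, ?_, hpf,
    adjOn_of_zeroSupp_eq haU hgU hpU fun e he => (hcomp e he).1,
    (adjOn_of_zeroSupp_eq ha'W hgW hpW fun e he => (hcomp e he).2).symm⟩
  rw [hpU]
  exact Finset.insert_subset_insert _ (Finset.erase_subset _ _)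

/-- The cocircuits with zero support in `F` that are crabbed for `X` and `Y` on `F` and agree with
`X` at `f`. -/
def OpenRegion (C : Set (SignVec E)) (F : Finset E) (f : E) (X Y U : SignVec E) : Prop :=
  U ∈ C ∧ zeroSupp U ⊆ F ∧ U f = X f ∧ ∀ e ∈ F, U e = 0 ∨ U e = X e ∨ U e = Y e

/-- In the case `F = X⁰ ∪ Y⁰ ∪ {f}` some neighbour of `X` in direction of `Y` avoids `f`. -/
lemma exists_neighbor_avoiding (h : IsUniformOM r C) {F : Finset E} {X Y : SignVec E} (hX : X ∈ C)
    (hY : Y ∈ C) {f : E} (hf : f ∈ F) (hXY : X f = Y f) (hXf : X f ≠ 0)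
    (hne : ¬ zeroSupp X ⊆ zeroSupp Y) (hF : ∀ g ∈ F, g ≠ f → X g = 0 ∨ Y g = 0)
    (hYF : zeroSupp Y ⊆ F) :
    ∃ U ∈ C, ∃ a, X a = 0 ∧ Y a ≠ 0 ∧ ∃ b ∈ F, X b ≠ 0 ∧ b ≠ f ∧
      zeroSupp U = insert b ((zeroSupp X).erase a) ∧ U a = Y a ∧ ∀ e ∈ F, CompatAt X U e := by
  -- Otherwise, for every `a` in `X⁰ \ Y⁰`, the neighbour of `X` that takes the sign of `Y` at `a`
  -- has `f` as its new zero.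
  by_contra! hcon
  have hnb : ∀ a ∈ zeroSupp X \ zeroSupp Y, ∃ U ∈ C,
      zeroSupp U = insert f ((zeroSupp X).erase a) ∧ U a = Y a ∧ ∀ e ∈ F, CompatAt X U e := by
    intro a ha
    simp only [Finset.mem_sdiff, mem_zeroSupp] at ha
    obtain ⟨U, hU, b, hb, hXb, hU0, hUa, hUc⟩ := h.exists_neighbor hX ha.1 hf hXf ha.2
    by_cases hbf : b = f
    · subst hbf
      exact ⟨U, hU, hU0, hUa, hUc⟩
    · obtain ⟨e, he, hce⟩ := hcon U hU a ha.1 ha.2 b hb hXb hbf hU0 hUa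
      exact absurd (hUc e he) hce
  have hcX := h.card_zeroSupp hX
  have hcY := h.card_zeroSupp hY
  obtain ⟨b, hbY, hbX⟩ : ∃ b, Y b = 0 ∧ X b ≠ 0 := by
    by_contra! hall
    refine hne (Finset.eq_of_subset_of_card_le (s := zeroSupp Y) (t := zeroSupp X)
      (fun x hx => ?_) (by omega)).ge
    simpa using hall x (by simpa using hx)
  have hbF : b ∈ F := hYF (by simpa using hbY)
  have hbf : b ≠ f := fun hb => hXf (by rw [hXY, ← hb, hbY])
  -- Start from `Y` and eliminate the elements of `X⁰ \ Y⁰` one by one against the negatives of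
  -- these neighbours. They vanish at `f` and agree with `X` at `b`, so the result can only have
  -- sign `X f` or `0` at `f`, and `-X b` or `0` at `b`.
  have main : ∀ J : Finset E, J ⊆ zeroSupp X \ zeroSupp Y → ∃ Z ∈ C,
      (∀ x ∈ J, Z x = 0) ∧ (∀ x, X x = 0 → Z x = 0 ∨ Z x = Y x) ∧ (Z f = 0 ∨ Z f = X f) ∧
      (Z b = 0 ∨ Z b = - X b) := by
    intro J
    induction J using Finset.induction_on with
    | empty =>
      intro _
      exact ⟨Y, hY, by simp, fun x _ => Or.inr rfl, Or.inr hXY.symm, Or.inl hbY⟩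
    | insert a J haJ ih =>
      intro hJ
      obtain ⟨Z, hZ, hZJ, hZX, hZf, hZb⟩ := ih fun x hx => hJ (Finset.mem_insert_of_mem hx)
      by_cases hZa : Z a = 0
      · refine ⟨Z, hZ, fun x hx => ?_, hZX, hZf, hZb⟩
        rcases Finset.mem_insert.1 hx with rfl | hx
        exacts [hZa, hZJ x hx]
      obtain ⟨U, hU, hU0, hUa, hUc⟩ := hnb a (hJ (Finset.mem_insert_self _ _))
      have haX : X a = 0 := by
        have := hJ (Finset.mem_insert_self a J)
        simp only [Finset.mem_sdiff, mem_zeroSupp] at this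
        exact this.1
      have hUx : ∀ x, X x = 0 → x ≠ a → U x = 0 := fun x hx hxa => by
        rw [← mem_zeroSupp, hU0]; simp [hx, hxa]
      have hUf : U f = 0 := by rw [← mem_zeroSupp, hU0]; simp
      have hUb : U b = X b := by
        have hne : U b ≠ 0 := by rw [Ne, ← mem_zeroSupp, hU0]; simp [hbf, hbX]
        rcases hUc b hbF with h' | h' | h'
        exacts [absurd h' hbX, absurd h' hne, h'.symm]
      have hZa' : Z a = Y a := (hZX a haX).resolve_left hZa
      obtain ⟨Z', hZ', hZ'a, hZ'f⟩ := h.elim hZ (h.neg_mem hU) (e := a) (fun hn => by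
        rw [neg_neg] at hn
        rw [hn, hUb] at hZb
        rcases hZb with hZb | hZb
        exacts [hbX hZb, sign_ne_neg_self hbX hZb]) (fun hc => by
          rw [CompatAt, Pi.neg_apply, hUa, hZa'] at hc
          rw [hZa'] at hZa
          revert hc hZa
          generalize Y a = t
          revert t; decide)
      refine ⟨Z', hZ', fun x hx => ?_, fun x hx => ?_, ?_, ?_⟩
      · rcases Finset.mem_insert.1 hx with rfl | hx'
        · exact hZ'a
        · have hx2 := hJ hx
          simp only [Finset.mem_sdiff, mem_zeroSupp] at hx2
          have h3 := hZ'f x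
          rw [hZJ x hx', Pi.neg_apply, hUx x hx2.1 (fun h => haJ (h ▸ hx'))] at h3
          simpa using h3
      · by_cases hxa : x = a
        · subst hxa; exact Or.inl hZ'a
        · have h3 := hZ'f x
          rw [Pi.neg_apply, hUx x hx hxa] at h3
          have h4 := hZX x hx
          rcases h3 with h3 | h3 | h3
          · rwa [h3]
          · exact Or.inl (by simpa using h3)
          · exact Or.inl h3
      · have h3 := hZ'f f
        rw [Pi.neg_apply, hUf] at h3
        rcases h3 with h3 | h3 | h3
        · rwa [h3]
        · exact Or.inl (by simpa using h3)
        · exact Or.inl h3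
      · have h3 := hZ'f b
        rw [Pi.neg_apply, hUb] at h3
        rcases h3 with h3 | h3 | h3
        · rwa [h3]
        · exact Or.inr h3
        · exact Or.inl h3
  obtain ⟨Z, hZ, hZJ, hZX, hZf, hZb⟩ := main _ subset_rfl
  have hsub : zeroSupp X ⊆ zeroSupp Z := by
    intro x hx
    rw [mem_zeroSupp] at hx ⊢
    by_cases hxY : Y x = 0
    · rcases hZX x hx with h' | h'
      exacts [h', h'.trans hxY]
    · exact hZJ x (by simp [hx, hxY])
  -- All of `X⁰` has been eliminated, so the result is `X` or `-X`; the sign at `b` excludes the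
  -- former, the sign at `f` the latter.
  rcases h.eq_or_eq_neg_of_subset hX hZ hsub with rfl | rfl
  · rcases hZb with hZb | hZb
    exacts [hbX hZb, sign_ne_neg_self hbX hZb]
  · rw [Pi.neg_apply] at hZf
    revert hZf hXf
    generalize X f = t
    revert t; decide

end IsUniformOM

end Reachability

/-! ### Connectedness on one open side of a hyperplane. -/

section OpenRegions

variable {E : Type*} [Fintype E]

namespace IsUniformOM

variable {r : ℕ} {C : Set (SignVec E)}

/-- Allows a connection found in the smaller region spanned by two intermediate vectors to be used
in the region of `X` and `Y`. -/
lemma OpenRegion.trans {F : Finset E} {f : E} {X Y P Q U : SignVec E} (hP : OpenRegion C F f X Y P)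
    (hQ : ∀ e ∈ F, Q e = 0 ∨ Q e = X e ∨ Q e = Y e) (hU : OpenRegion C F f P Q U) :
    OpenRegion C F f X Y U := by
  refine ⟨hU.1, hU.2.1, hU.2.2.1.trans hP.2.2.1, fun e he => ?_⟩
  rcases hU.2.2.2 e he with h' | h' | h' <;> rw [h']
  exacts [Or.inl rfl, hP.2.2.2 e he, hQ e he]

lemma OpenRegion.eq_zero {F : Finset E} {f : E} {X Y U : SignVec E} (hU : OpenRegion C F f X Y U)
    {e : E} (he : e ∈ F) (hX : X e = 0) (hY : Y e = 0) : U e = 0 := by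
  simpa [hX, hY] using hU.2.2.2 e he

variable [DecidableEq E]

/-- The vertices of an open region are connected, in every deletion of the oriented matroid. -/
lemma reach_openRegion (h : IsUniformOM r C) (k : ℕ) :
    ∀ (F : Finset E) (X Y : SignVec E) (f : E), X ∈ C → Y ∈ C → zeroSupp X ⊆ F → zeroSupp Y ⊆ F →
      f ∈ F → X f = Y f → X f ≠ 0 → (zeroSupp X \ zeroSupp Y).card ≤ k →
      Reach F (OpenRegion C F f X Y) X Y := by
  have hsub : ∀ {X Y : SignVec E} {f : E}, X ∈ C → Y ∈ C → X f = Y f → X f ≠ 0 →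
      zeroSupp X ⊆ zeroSupp Y → X = Y := by
    intro X Y f hX hY hf hXf hXY
    rcases h.eq_or_eq_neg_of_subset hX hY hXY with rfl | rfl
    · rfl
    · exact absurd hf (sign_ne_neg_self hXf)
  -- Outer induction on the dimension, inner induction on the set `F` of undeleted elements.
  induction k with
  | zero =>
    intro F X Y f hX hY _ _ _ hf hXf hk
    rw [hsub hX hY hf hXf (Finset.sdiff_eq_empty_iff_subset.1 (Finset.card_eq_zero.1 (by omega)))]
    exact Reach.refl _
  | succ k ihk =>
    intro F
    induction F using Finset.strongInduction with
    | H F ihF =>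
      intro X Y f hX hY hXF hYF hf hXYf hXf hk
      by_cases hg : ∃ g ∈ F, g ≠ f ∧ X g ≠ 0 ∧ Y g ≠ 0
      · obtain ⟨g, hgF, hgf, hXg, hYg⟩ := hg
        have hX' : zeroSupp X ⊆ F.erase g := Finset.subset_erase.2 ⟨hXF, by simpa using hXg⟩
        have hY' : zeroSupp Y ⊆ F.erase g := Finset.subset_erase.2 ⟨hYF, by simpa using hYg⟩
        have hpath := ihF (F.erase g) (Finset.erase_ssubset hgF) X Y f hX hY hX' hY'
          (Finset.mem_erase.2 ⟨hgf.symm, hf⟩) hXYf hXf hk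
        have hnz : ∀ {U}, OpenRegion C (F.erase g) f X Y U → U g ≠ 0 := fun hU hUg => by
          simpa using hU.2.1 (mem_zeroSupp.2 hUg)
        have hreg : ∀ {U}, OpenRegion C (F.erase g) f X Y U →
            (OpenRegion C F f X Y U ↔ U g = X g ∨ U g = Y g) := by
          intro U hU
          constructor
          · intro hU'
            exact (hU'.2.2.2 g hgF).resolve_left (hnz hU)
          · intro hU'
            refine ⟨hU.1, hU.2.1.trans (Finset.erase_subset _ _), hU.2.2.1, fun e he => ?_⟩
            by_cases heg : e = g
            · subst heg; exact Or.inr hU'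
            · exact hU.2.2.2 e (Finset.mem_erase.2 ⟨heg, he⟩)
        -- Two vertices of the region on the hyperplane `g` share the zeros `X⁰ ∩ Y⁰` and also `g`,
        -- so the outer induction connects them.
        have hjoin : ∀ p q : SignVec E, OpenRegion C F f X Y p → OpenRegion C F f X Y q →
            p g = 0 → q g = 0 → Reach F (OpenRegion C F f X Y) p q := by
          intro p q hp hq hpg hqg
          refine (ihk F p q f hp.1 hq.1 hp.2.1 hq.2.1 hf (hp.2.2.1.trans hq.2.2.1.symm)
            (by rw [hp.2.2.1]; exact hXf) ?_).mono fun U hU => hp.trans hq.2.2.2 hU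
          have h1 := h.card_zeroSupp hX
          have h2 := h.card_zeroSupp hp.1
          have h3 : insert g (zeroSupp X ∩ zeroSupp Y) ⊆ zeroSupp p ∩ zeroSupp q := by
            intro x hx
            rw [Finset.mem_insert, Finset.mem_inter] at hx
            rw [Finset.mem_inter, mem_zeroSupp, mem_zeroSupp]
            rcases hx with rfl | hx
            · exact ⟨hpg, hqg⟩
            · have hxF := hXF hx.1
              rw [mem_zeroSupp, mem_zeroSupp] at hx
              exact ⟨hp.eq_zero hxF hx.1 hx.2, hq.eq_zero hxF hx.1 hx.2⟩
          have h4 := Finset.card_le_card h3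
          rw [Finset.card_insert_of_notMem (by simp [hXg])] at h4
          have h5 := Finset.card_sdiff_add_card_inter (zeroSupp p) (zeroSupp q)
          have h6 := Finset.card_sdiff_add_card_inter (zeroSupp X) (zeroSupp Y)
          omega
        have hcross : ∀ {U W}, OpenRegion C (F.erase g) f X Y U →
            OpenRegion C (F.erase g) f X Y W → AdjOn (F.erase g) U W → U g ≠ W g →
            ∃ p, OpenRegion C F f X Y p ∧ p g = 0 ∧ AdjOn F U p ∧ AdjOn F p W := by
          intro U W hU hW hUW hne
          obtain ⟨p, hp, hpg, hpU, hpf, hA, hB⟩ := h.exists_crossing hU.1 hW.1 hUW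
            (fun hc => by
              rcases hc with hc | hc | hc
              exacts [hnz hU hc, hnz hW hc, hne hc])
          refine ⟨p, ⟨hp, ?_, ?_, fun e he => ?_⟩, hpg, hA, hB⟩
          · exact hpU.trans (Finset.insert_subset hgF (hU.2.1.trans (Finset.erase_subset _ _)))
          · have hUf : U f ≠ 0 := by rw [hU.2.2.1]; exact hXf
            have hpf0 : p f ≠ 0 := fun hpf0 => by
              rcases Finset.mem_insert.1 (hpU (mem_zeroSupp.2 hpf0)) with h' | h'
              · exact hgf h'.symm
              · exact hUf (by simpa using h')
            have := hpf f
            rw [hU.2.2.1, hW.2.2.1] at this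
            tauto
          · by_cases heg : e = g
            · subst heg; exact Or.inl hpg
            · have heF := Finset.mem_erase.2 ⟨heg, he⟩
              rcases hpf e with h' | h' | h' <;> rw [h']
              exacts [hU.2.2.2 e heF, hW.2.2.2 e heF, Or.inl rfl]
        have hXreg : OpenRegion C (F.erase g) f X Y X :=
          ⟨hX, hX', rfl, fun e _ => Or.inr (Or.inl rfl)⟩
        have hYreg : OpenRegion C (F.erase g) f X Y Y :=
          ⟨hY, hY', hXYf.symm, fun e _ => Or.inr (Or.inr rfl)⟩
        -- Follow the path of the deletion. While it is on an allowed side of `g` it is kept; while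
        -- it is on a forbidden side, only some reachable vertex `p` on `g` is remembered, and
        -- `hjoin` bridges the excursion when the path returns.
        have main : ∀ U, Reach (F.erase g) (OpenRegion C (F.erase g) f X Y) X U →
            OpenRegion C (F.erase g) f X Y U ∧
            (OpenRegion C F f X Y U → Reach F (OpenRegion C F f X Y) X U) ∧
            (¬ OpenRegion C F f X Y U → ∃ p, OpenRegion C F f X Y p ∧ p g = 0 ∧
              Reach F (OpenRegion C F f X Y) X p) := by
          intro U hU
          induction hU with
          | refl => exact ⟨hXreg, fun _ => Reach.refl _,
              fun hn => absurd ((hreg hXreg).2 (Or.inl rfl)) hn⟩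
          | @tail U W hXU hUW ih =>
            obtain ⟨hU, hW, hadj⟩ := hUW
            refine ⟨hW, ?_⟩
            obtain ⟨-, ih1, ih2⟩ := ih
            by_cases hne : U g = W g
            · have hiff : OpenRegion C F f X Y U ↔ OpenRegion C F f X Y W := by
                rw [hreg hU, hreg hW, hne]
              refine ⟨fun hW' => ?_, fun hW' => ih2 (fun hU' => hW' (hiff.1 hU'))⟩
              have hU' := hiff.2 hW'
              refine (ih1 hU').trans (Reach.single hU' hW' ⟨hadj.1, fun e he => ?_⟩)
              by_cases heg : e = g
              · subst heg; exact Or.inr (Or.inr hne)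
              · exact hadj.2 e (Finset.mem_erase.2 ⟨heg, he⟩)
            · obtain ⟨p, hp, hpg, hUp, hpW⟩ := hcross hU hW hadj hne
              have hXp : Reach F (OpenRegion C F f X Y) X p := by
                by_cases hU' : OpenRegion C F f X Y U
                · exact (ih1 hU').trans (Reach.single hU' hp hUp)
                · obtain ⟨q, hq, hqg, hXq⟩ := ih2 hU'
                  exact hXq.trans (hjoin q p hq hp hqg hpg)
              exact ⟨fun hW' => hXp.trans (Reach.single hp hW' hpW), fun _ => ⟨p, hp, hpg, hXp⟩⟩
        exact (main Y hpath).2.1 ((hreg hYreg).2 (Or.inr rfl))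
      -- Nothing can be deleted, so each element of `F` other than `f` is a zero of `X` or of `Y`. A
      -- step to a neighbour whose new zero `b` is not `f`, hence a zero of `Y`, lowers the
      -- dimension.
      · push Not at hg
        by_cases hXY : zeroSupp X ⊆ zeroSupp Y
        · rw [hsub hX hY hXYf hXf hXY]
          exact Reach.refl _
        obtain ⟨U, hU, a, hXa, hYa, b, hb, hXb, hbf, hU0, hUa, hUc⟩ :=
          h.exists_neighbor_avoiding hX hY hf hXYf hXf hXY
            (fun g hgF hgf => or_iff_not_imp_left.2 (hg g hgF hgf)) hYF
        have hYb : Y b = 0 := hg b hb hbf hXb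
        have hUb : U b = 0 := by rw [← mem_zeroSupp, hU0]; simp
        have hUF : zeroSupp U ⊆ F := by
          rw [hU0]; exact Finset.insert_subset hb ((Finset.erase_subset _ _).trans hXF)
        have hUf : U f = X f := by
          have hne : U f ≠ 0 := by rw [Ne, ← mem_zeroSupp, hU0]; simp [hbf.symm, hXf]
          rcases hUc f hf with h' | h' | h'
          exacts [absurd h' hXf, absurd h' hne, h'.symm]
        have hUreg : OpenRegion C F f X Y U := by
          refine ⟨hU, hUF, hUf, fun e he => ?_⟩
          by_cases hea : e = a
          · subst hea; exact Or.inr (Or.inr hUa)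
          · rcases hUc e he with h' | h' | h'
            · refine Or.inl ?_
              rw [← mem_zeroSupp, hU0]; simp [hea, h']
            · exact Or.inl h'
            · exact Or.inr (Or.inl h'.symm)
        have hstep : Reach F (OpenRegion C F f X Y) X U :=
          Reach.single ⟨hX, hXF, rfl, fun e _ => Or.inr (Or.inl rfl)⟩ hUreg
            (adjOn_of_zeroSupp_eq hXa hXb hU0 hUc)
        refine hstep.trans ((ihk F U Y f hU hY hUF hYF hf (hUf.trans hXYf) (by rwa [hUf]) ?_).mono
          fun W hW => hUreg.trans (fun e _ => Or.inr (Or.inr rfl)) hW)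
        have : zeroSupp U \ zeroSupp Y ⊆ (zeroSupp X \ zeroSupp Y).erase a := by
          intro x
          rw [hU0]
          simp only [Finset.mem_sdiff, Finset.mem_insert, Finset.mem_erase, mem_zeroSupp]
          rintro ⟨rfl | hx, hxY⟩
          · exact absurd hYb hxY
          · exact ⟨hx.1, hx.2, hxY⟩
        have := Finset.card_le_card this
        rw [Finset.card_erase_of_mem (by simp [hXa, hYa])] at this
        omega

end IsUniformOM

end OpenRegions

/-! ### Regions after the removal of vertices. -/

section Regions

variable {E : Type*} [Fintype E]

/-- The members of `C` that vanish on `A` and take at every `e` a value in `K e`. -/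
def InRegion (C : Set (SignVec E)) (A : Finset E) (K : E → Set SignType) (U : SignVec E) : Prop :=
  U ∈ C ∧ (∀ e ∈ A, U e = 0) ∧ ∀ e, U e ∈ K e

namespace IsUniformOM

variable {r : ℕ} {C : Set (SignVec E)} {A : Finset E} {K : E → Set SignType}

/-- The zero vector is its own negative, whereas (C2) asks for two distinct vectors on each
admissible support. -/
lemma exists_ne_zero (h : IsUniformOM r C) {X : SignVec E} (hX : X ∈ C) : ∃ f, X f ≠ 0 := by
  by_contra! hall
  obtain ⟨P, Q, hne, rfl, hPQ⟩ := h.c2 (supp X) (h.c1 X hX)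
  have hP : P ∈ {Z | Z ∈ C ∧ supp Z = supp X} := hPQ ▸ Or.inl rfl
  have hP0 : P = 0 := by
    funext e
    have := Finset.ext_iff.1 hP.2 e
    simpa [supp, hall e] using this
  exact hne (by rw [hP0, neg_zero])

variable [DecidableEq E]

/-- Compatibility on all of `E` keeps the neighbour in the region: away from `a` its values are `0`
or those of `U`. -/
lemma exists_region_neighbor (h : IsUniformOM r C) (hK0 : ∀ e, 0 ∈ K e) {U : SignVec E}
    (hU : InRegion C A K U) {a : E} (haA : a ∉ A) (ha : U a = 0) {s : SignType} (hs : s ≠ 0)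
    (hsK : s ∈ K a) :
    ∃ W, InRegion C A K W ∧ W a = s ∧ (∀ x, x ≠ a → U x = 0 → W x = 0) ∧
      AdjOn Finset.univ U W := by
  obtain ⟨f, hf⟩ := h.exists_ne_zero hU.1
  obtain ⟨W, hW, b, -, hb, hW0, hWa, hc⟩ :=
    h.exists_neighbor hU.1 ha (Finset.mem_univ f) hf hs
  have hWx : ∀ x, x ≠ a → U x = 0 → W x = 0 := fun x hxa hx => by
    rw [← mem_zeroSupp, hW0]; simp [hxa, hx]
  refine ⟨W, ⟨hW, fun e he => hWx e (fun h => haA (h ▸ he)) (hU.2.1 e he), fun e => ?_⟩, hWa, hWx,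
    adjOn_of_zeroSupp_eq ha hb hW0 hc⟩
  by_cases hea : e = a
  · subst hea; rwa [hWa]
  · rcases hc e (Finset.mem_univ e) with h' | h' | h'
    · rw [hWx e hea h']; exact hK0 e
    · rw [h']; exact hK0 e
    · rw [← h']; exact hU.2.2 e

/-- A nonempty region of dimension `d` has more than `d` vertices. -/
lemma exists_region_notMem (h : IsUniformOM r C) (hK0 : ∀ e, 0 ∈ K e)
    (hK : ∀ e ∉ A, ∃ s ∈ K e, s ≠ 0) {U : SignVec E} (hU : InRegion C A K U)
    {T : Finset (SignVec E)} (hT : T.card + A.card < r) : ∃ W, InRegion C A K W ∧ W ∉ T := by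
  by_contra! hall
  have hUT := hall U hU
  -- Together with `U` itself, the neighbours that free the different elements of `U⁰ \ A` are
  -- enough vertices; they are distinct since each is nonzero only at its own `a` among the zeros of
  -- `U`.
  have hnb : ∀ a ∈ zeroSupp U \ A, ∃ W, InRegion C A K W ∧ W a ≠ 0 ∧
      (∀ x, x ≠ a → U x = 0 → W x = 0) := by
    intro a ha
    rw [Finset.mem_sdiff, mem_zeroSupp] at ha
    obtain ⟨s, hs, hs0⟩ := hK a ha.2
    obtain ⟨W, hW, hWa, hWx, -⟩ := h.exists_region_neighbor hK0 hU ha.2 ha.1 hs0 hs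
    exact ⟨W, hW, by rwa [hWa], hWx⟩
  choose! W hW hWa hWx using hnb
  have hle : (zeroSupp U \ A).card ≤ (T.erase U).card := by
    refine Finset.card_le_card_of_injOn W (fun a ha => ?_) (fun a ha b hb hab => ?_)
    · have ha' := ha
      rw [Finset.mem_coe, Finset.mem_sdiff, mem_zeroSupp] at ha'
      exact Finset.mem_erase.2 ⟨fun he => hWa a ha (by rw [he, ha'.1]), hall _ (hW a ha)⟩
    · by_contra hne
      have hb' := hb
      rw [Finset.mem_coe, Finset.mem_sdiff, mem_zeroSupp] at hb'
      exact hWa b hb (by rw [← hab]; exact hWx a ha b (Ne.symm hne) hb'.1)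
  have hcU := h.card_zeroSupp hU.1
  rw [Finset.card_erase_of_mem hUT, Finset.card_sdiff_of_subset
    (fun x hx => mem_zeroSupp.2 (hU.2.1 x hx))] at hle
  have : 0 < T.card := Finset.card_pos.2 ⟨U, hUT⟩
  omega

/-- Vertices of a region that agree and are nonzero at `e` are connected off the zero set
of `e`. -/
lemma reach_region_of_eq (h : IsUniformOM r C) (hK0 : ∀ e, 0 ∈ K e) {T : Finset (SignVec E)}
    {e : E} (hT : ∀ t ∈ T, t e = 0) {Z W : SignVec E} (hZ : InRegion C A K Z)
    (hW : InRegion C A K W) (hZW : Z e = W e) (hZe : Z e ≠ 0) :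
    Reach Finset.univ (fun U => InRegion C A K U ∧ U ∉ T) Z W := by
  refine (h.reach_openRegion _ Finset.univ Z W e hZ.1 hW.1 (Finset.subset_univ _)
    (Finset.subset_univ _) (Finset.mem_univ _) hZW hZe le_rfl).mono fun U hU => ?_
  refine ⟨⟨hU.1, fun x hx => hU.eq_zero (Finset.mem_univ x) (hZ.2.1 x hx) (hW.2.1 x hx),
    fun x => ?_⟩, fun hUT => hZe (by rw [← hU.2.2.1]; exact hT U hUT)⟩
  rcases hU.2.2.2 x (Finset.mem_univ x) with h' | h' | h' <;> rw [h']
  exacts [hK0 x, hZ.2.2 x, hW.2.2 x]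

/-- If all removed vertices lie in a hyperplane `e`, then the rest of the region is connected. -/
lemma reach_region_of_forall_eq_zero (h : IsUniformOM r C) (hK0 : ∀ e, 0 ∈ K e)
    (hK : ∀ e ∉ A, ∃ s ∈ K e, s ≠ 0) {T : Finset (SignVec E)} {e : E} (heA : e ∉ A)
    (hT : ∀ t ∈ T, t e = 0) (hcard : T.card + A.card + 1 < r) {q : SignVec E}
    (hq : InRegion C A K q) (hqe : q e = 0) {Z W : SignVec E}
    (hZ : InRegion C A K Z) (hZT : Z ∉ T) (hW : InRegion C A K W) (hWT : W ∉ T) :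
    Reach Finset.univ (fun U => InRegion C A K U ∧ U ∉ T) Z W := by
  have hoff : ∀ {U : SignVec E}, U e ≠ 0 → U ∉ T := fun hU hUT => hU (hT _ hUT)
  have hmove : ∀ {U s}, InRegion C A K U → U ∉ T → U e = 0 → s ∈ K e → s ≠ 0 →
      ∃ U', InRegion C A K U' ∧ U' e = s ∧
        Reach Finset.univ (fun U => InRegion C A K U ∧ U ∉ T) U U' := by
    intro U s hU hUT hUe hs hs0
    obtain ⟨U', hU', hU'e, -, hadj⟩ := h.exists_region_neighbor hK0 hU heA hUe hs0 hs
    exact ⟨U', hU', hU'e, Reach.single ⟨hU, hUT⟩ ⟨hU', hoff (by rwa [hU'e])⟩ hadj⟩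
  have hnz : ∀ {Z W : SignVec E}, InRegion C A K Z → InRegion C A K W → Z e ≠ 0 → W e ≠ 0 →
      Reach Finset.univ (fun U => InRegion C A K U ∧ U ∉ T) Z W := by
    intro Z W hZ hW hZe hWe
    by_cases hZW : Z e = W e
    · exact h.reach_region_of_eq hK0 hT hZ hW hZW hZe
    have hq' : InRegion C (insert e A) K q := ⟨hq.1, fun x hx => by
      rcases Finset.mem_insert.1 hx with rfl | hx
      exacts [hqe, hq.2.1 x hx], hq.2.2⟩
    -- The facet on `e` has more vertices than `T`, so a surviving one serves as a gate between the
    -- two sides.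
    obtain ⟨p, hp, hpT⟩ := h.exists_region_notMem hK0
      (fun x hx => hK x fun hxA => hx (Finset.mem_insert_of_mem hxA)) hq' (T := T) (by
        rw [Finset.card_insert_of_notMem heA]; omega)
    have hpe := hp.2.1 e (Finset.mem_insert_self e A)
    have hp' : InRegion C A K p := ⟨hp.1, fun x hx => hp.2.1 x (Finset.mem_insert_of_mem hx), hp.2.2⟩
    obtain ⟨P, hP, hPe, hpP⟩ := hmove hp' hpT hpe (hZ.2.2 e) hZe
    obtain ⟨Q, hQ, hQe, hpQ⟩ := hmove hp' hpT hpe (hW.2.2 e) hWe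
    exact ((h.reach_region_of_eq hK0 hT hZ hP hPe.symm hZe).trans hpP.symm).trans
      (hpQ.trans (h.reach_region_of_eq hK0 hT hQ hW hQe (by rwa [hQe])))
  have hleave : ∀ {U}, InRegion C A K U → U ∉ T → ∃ U', InRegion C A K U' ∧ U' e ≠ 0 ∧
      Reach Finset.univ (fun U => InRegion C A K U ∧ U ∉ T) U U' := by
    intro U hU hUT
    by_cases hUe : U e = 0
    · obtain ⟨s, hs, hs0⟩ := hK e heA
      obtain ⟨U', hU', hU'e, hUU'⟩ := hmove hU hUT hUe hs hs0
      exact ⟨U', hU', by rwa [hU'e], hUU'⟩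
    · exact ⟨U, hU, hUe, Reach.refl U⟩
  obtain ⟨Z', hZ', hZ'e, hZZ'⟩ := hleave hZ hZT
  obtain ⟨W', hW', hW'e, hWW'⟩ := hleave hW hWT
  exact (hZZ'.trans (hnz hZ' hW' hZ'e hW'e)).trans hWW'.symm

/-- A region of dimension `k` stays connected after the removal of fewer than `k` vertices. -/
theorem reach_region (h : IsUniformOM r C) (hK0 : ∀ e, 0 ∈ K e) (k : ℕ) :
    ∀ (A : Finset E), (∀ e ∉ A, ∃ s ∈ K e, s ≠ 0) → A.card + k + 1 = r →
      ∀ (T : Finset (SignVec E)), T.card < k → ∀ Z W, InRegion C A K Z → Z ∉ T →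
        InRegion C A K W → W ∉ T →
        Reach Finset.univ (fun U => InRegion C A K U ∧ U ∉ T) Z W := by
  induction k with
  | zero => intro A _ _ T hT; omega
  | succ k ih =>
    intro A hK hA T hT Z W hZ hZT hW hWT
    have hex : ∀ U ∈ C, ∃ e ∈ zeroSupp U, e ∉ A := fun U hU => by
      have := h.card_zeroSupp hU
      exact Finset.exists_mem_notMem_of_card_lt_card (by omega)
    by_cases hcase : ∃ e ∉ A, (∀ t ∈ T, t e = 0) ∧ ∃ q, InRegion C A K q ∧ q e = 0
    · obtain ⟨e, heA, hTe, q, hq, hqe⟩ := hcase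
      exact h.reach_region_of_forall_eq_zero hK0 hK heA hTe (by omega) hq hqe hZ hZT hW hWT
    push Not at hcase
    have hins : ∀ {U e}, InRegion C A K U → U e = 0 → InRegion C (insert e A) K U :=
      fun hU hUe => ⟨hU.1, fun x hx => by
        rcases Finset.mem_insert.1 hx with rfl | hx
        exacts [hUe, hU.2.1 x hx], hU.2.2⟩
    -- No hyperplane meeting the region contains `T`, so each facet loses strictly fewer vertices,
    -- as the induction requires. This also forces `T` to be nonempty, hence `k ≥ 1`.
    have hTcard : ∀ {U e}, e ∉ A → InRegion C A K U → U e = 0 →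
        (T.filter fun t => t e = 0).card < T.card := by
      intro U e he hU hUe
      refine Finset.card_lt_card ⟨Finset.filter_subset _ _, fun hsub => ?_⟩
      exact hcase e he (fun t ht => (Finset.mem_filter.1 (hsub ht)).2) U hU hUe
    have hface : ∀ {U V e}, e ∉ A → InRegion C A K U → U e = 0 → U ∉ T → InRegion C A K V →
        V e = 0 → V ∉ T → Reach Finset.univ (fun U => InRegion C A K U ∧ U ∉ T) U V := by
      intro U V e he hU hUe hUT hV hVe hVT
      have hlt := hTcard he hU hUe
      refine (ih (insert e A) (fun x hx => hK x fun hxA => hx (Finset.mem_insert_of_mem hxA))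
        (by rw [Finset.card_insert_of_notMem he]; omega) (T.filter fun t => t e = 0) (by omega)
        U V (hins hU hUe) (fun hm => hUT (Finset.mem_filter.1 hm).1)
        (hins hV hVe) (fun hm => hVT (Finset.mem_filter.1 hm).1)).mono fun P hP => ?_
      refine ⟨⟨hP.1.1, fun x hx => hP.1.2.1 x (Finset.mem_insert_of_mem hx), hP.1.2.2⟩,
        fun hPT => hP.2 (Finset.mem_filter.2 ⟨hPT, hP.1.2.1 e (Finset.mem_insert_self e A)⟩)⟩
    obtain ⟨e₀, he₀, he₀A⟩ := hex Z hZ.1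
    have hpath := h.reach_region_of_forall_eq_zero hK0 hK (T := ∅) he₀A (by simp)
      (by rw [Finset.card_empty]; omega) hZ (by simpa using he₀) hZ (by simp) hW (by simp)
    -- The vertices of the unrestricted path may lie in `T`, so the invariant speaks of the
    -- surviving vertices on every facet through the current vertex.
    have main : ∀ U, Reach Finset.univ (fun U => InRegion C A K U ∧ U ∉ (∅ : Finset (SignVec E))) Z U →
        ∀ e ∉ A, U e = 0 → ∀ p, InRegion C A K p → p e = 0 → p ∉ T →
          Reach Finset.univ (fun U => InRegion C A K U ∧ U ∉ T) Z p := by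
      intro U hU
      induction hU with
      | refl =>
        intro e he hZe p hp hpe hpT
        exact hface he hZ hZe hZT hp hpe hpT
      | @tail U V _ hUV ihU =>
        obtain ⟨⟨hU, -⟩, ⟨hV, -⟩, hadj⟩ := hUV
        intro e he hVe p hp hpe hpT
        have hlt := hTcard he hV hVe
        have hcU := h.card_zeroSupp hU.1
        have hcV := h.card_zeroSupp hV.1
        obtain ⟨a, haU, -, b, -, -, hab⟩ := exists_exchange_of_card_symmDiff
          (by omega : (zeroSupp U).card = (zeroSupp V).card) hadj.1
        obtain ⟨e', he', he'A⟩ : ∃ e' ∈ (zeroSupp U).erase a, e' ∉ A :=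
          Finset.exists_mem_notMem_of_card_lt_card (by
            rw [Finset.card_erase_of_mem haU]; omega)
        have hUe' : U e' = 0 := by simpa using Finset.mem_of_mem_erase he'
        have hVe' : V e' = 0 := by
          rw [← mem_zeroSupp, hab]; exact Finset.mem_insert_of_mem he'
        by_cases hee : e = e'
        · subst hee
          exact ihU e he hUe' p hp hpe hpT
        have hcard : (insert e (insert e' A)).card = A.card + 2 := by
          rw [Finset.card_insert_of_notMem (by simp [hee, he]),
            Finset.card_insert_of_notMem he'A]
        have hV2 : InRegion C (insert e (insert e' A)) K V := ⟨hV.1, fun x hx => by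
          rcases Finset.mem_insert.1 hx with rfl | hx
          · exact hVe
          · exact (hins hV hVe').2.1 x hx, hV.2.2⟩
        -- The facets `e` and `e'` meet in a face of dimension `k - 1`, which has at least `k`
        -- vertices; fewer than `k` removed ones lie on `e`, so a common vertex survives.
        obtain ⟨q, hq, hqT⟩ := h.exists_region_notMem hK0
          (fun x hx => hK x fun hxA => hx (by simp [hxA])) hV2
          (T := T.filter fun t => t e = 0) (by omega)
        have hqe : q e = 0 := hq.2.1 e (by simp)
        have hqe' : q e' = 0 := hq.2.1 e' (by simp)
        have hqA : InRegion C A K q := ⟨hq.1, fun x hx => hq.2.1 x (by simp [hx]), hq.2.2⟩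
        have hqT' : q ∉ T := fun hm => hqT (Finset.mem_filter.2 ⟨hm, hqe⟩)
        exact (ihU e' he'A hUe' q hqA hqe' hqT').trans (hface he hqA hqe hqT' hp hpe hpT)
    obtain ⟨e, he, heA⟩ := hex W hW.1
    exact main W hpath e heA (by simpa using he) W hW (by simpa using he) hWT

end IsUniformOM

end Regions

/-! ### Menger's theorem for two sets of vertices. -/

section Menger

open SimpleGraph

variable {V : Type*}

/-- There are `k` walks from `A` to `B` with pairwise disjoint supports. -/
def Linked (G : SimpleGraph V) (A B : Finset V) (k : ℕ) : Prop :=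
  ∃ U : Fin k → Set V, (∀ i j, i ≠ j → Disjoint (U i) (U j)) ∧
    ∀ i, ∃ a ∈ A, ∃ b ∈ B, ∃ p : G.Walk a b, ∀ u ∈ p.support, u ∈ U i

lemma Linked.symm {G : SimpleGraph V} {A B : Finset V} {k : ℕ} (h : Linked G A B k) :
    Linked G B A k := by
  obtain ⟨U, hU, hp⟩ := h
  refine ⟨U, hU, fun i => ?_⟩
  obtain ⟨a, ha, b, hb, p, hp⟩ := hp i
  exact ⟨b, hb, a, ha, p.reverse, by simpa using hp⟩

lemma Linked.mono {G H : SimpleGraph V} (hGH : G ≤ H) {A B : Finset V} {k : ℕ}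
    (h : Linked G A B k) : Linked H A B k := by
  obtain ⟨U, hU, hp⟩ := h
  refine ⟨U, hU, fun i => ?_⟩
  obtain ⟨a, ha, b, hb, p, hp⟩ := hp i
  exact ⟨a, ha, b, hb, p.mapLe hGH, by simpa using hp⟩

/-- If the number of linking walks is the size of the target set, they can be indexed by it. -/
lemma Linked.exists_indexed {G : SimpleGraph V} {A S : Finset V} {k : ℕ} (h : Linked G A S k)
    (hS : S.card = k) : ∃ U : V → Set V, (∀ s ∈ S, ∀ t ∈ S, ∀ u, u ∈ U s → u ∈ U t → s = t) ∧
      ∀ s ∈ S, ∃ a ∈ A, ∃ p : G.Walk a s, p.IsPath ∧ ∀ u, u ∈ U s ↔ u ∈ p.support := by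
  classical
  obtain ⟨U, hU, hp⟩ := h
  choose a ha b hb p hp using hp
  have hinj : Function.Injective b := by
    intro i j hij
    by_contra hne
    exact Set.disjoint_left.1 (hU i j hne) (hp i _ (p i).end_mem_support)
      (hij ▸ hp j _ (p j).end_mem_support)
  have hsurj : ∀ s ∈ S, ∃ i, b i = s := by
    have himg : Finset.univ.image b = S := by
      refine Finset.eq_of_subset_of_card_le (fun x hx => ?_) ?_
      · obtain ⟨i, -, rfl⟩ := Finset.mem_image.1 hx
        exact hb i
      · rw [Finset.card_image_of_injective _ hinj, Finset.card_univ, Fintype.card_fin, hS]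
    intro s hs
    rw [← himg] at hs
    obtain ⟨i, -, hi⟩ := Finset.mem_image.1 hs
    exact ⟨i, hi⟩
  refine ⟨fun s => {u | ∃ i, b i = s ∧ u ∈ (p i).bypass.support}, ?_, ?_⟩
  · rintro s - t - u ⟨i, rfl, hi⟩ ⟨j, rfl, hj⟩
    by_contra hne
    exact Set.disjoint_left.1 (hU i j fun h => hne (h ▸ rfl))
      (hp i _ ((p i).support_bypass_subset_support hi)) (hp j _ ((p j).support_bypass_subset_support hj))
  · intro s hs
    obtain ⟨i, rfl⟩ := hsurj s hs
    refine ⟨a i, ha i, (p i).bypass, (p i).bypass_isPath, fun u => ⟨?_, fun hu => ⟨i, rfl, hu⟩⟩⟩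
    rintro ⟨j, hj, hu⟩
    obtain rfl := hinj hj
    exact hu

/-- The vertices reachable from `A` by walks avoiding `S`. -/
def ReachAvoiding (G : SimpleGraph V) (A S : Finset V) (v : V) : Prop :=
  ∃ a ∈ A, ∃ p : G.Walk a v, ∀ u ∈ p.support, u ∉ S

lemma ReachAvoiding.step {G : SimpleGraph V} {A S : Finset V} {v w : V}
    (h : ReachAvoiding G A S v) (hvw : G.Adj v w) (hw : w ∉ S) : ReachAvoiding G A S w := by
  obtain ⟨a, ha, p, hp⟩ := h
  refine ⟨a, ha, p.concat hvw, fun u hu => ?_⟩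
  rw [Walk.support_concat, List.mem_append, List.mem_singleton] at hu
  rcases hu with hu | rfl
  exacts [hp u hu, hw]

lemma ReachAvoiding.join {G : SimpleGraph V} {A B S : Finset V} {v : V}
    (hA : ReachAvoiding G A S v) (hB : ReachAvoiding G B S v) :
    ∃ b ∈ B, ReachAvoiding G A S b := by
  obtain ⟨a, ha, p, hp⟩ := hA
  obtain ⟨b, hb, q, hq⟩ := hB
  refine ⟨b, hb, a, ha, p.append q.reverse, fun u hu => ?_⟩
  rw [Walk.mem_support_append_iff, Walk.support_reverse, List.mem_reverse] at hu
  exact hu.elim (hp u) (hq u)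

variable [DecidableEq V]

/-- If `S` separates `A` from `B` in `G - xy` and `y` is not on the side of `A`, then every walk of
`G` from the side of `A` to `B` contains a walk of `G - xy` ending in `S ∪ {x}`. -/
lemma exists_walk_to_separator {G : SimpleGraph V} {A B S : Finset V} {x y : V}
    (hS : ∀ b ∈ B, ¬ ReachAvoiding (G.deleteEdges {s(x, y)}) A S b)
    (hy : ¬ ReachAvoiding (G.deleteEdges {s(x, y)}) A S y) {a b : V} (p : G.Walk a b) (hb : b ∈ B)
    (ha : a ∉ S → ReachAvoiding (G.deleteEdges {s(x, y)}) A S a) :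
    ∃ s ∈ insert x S, ∃ q : (G.deleteEdges {s(x, y)}).Walk a s,
      ∀ u ∈ q.support, u ∈ p.support := by
  induction p with
  | @nil a =>
    by_cases haS : a ∈ insert x S
    · exact ⟨_, haS, Walk.nil, by simp⟩
    · exact absurd (ha fun h => haS (Finset.mem_insert_of_mem h)) (hS _ hb)
  | @cons a c b hac p ih =>
    by_cases haS : a ∈ insert x S
    · exact ⟨a, haS, Walk.nil, by simp⟩
    have ha' := ha fun h => haS (Finset.mem_insert_of_mem h)
    have hadj : (G.deleteEdges {s(x, y)}).Adj a c := by
      rw [deleteEdges_adj]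
      refine ⟨hac, fun he => ?_⟩
      rw [Set.mem_singleton_iff, Sym2.eq_iff] at he
      rcases he with ⟨rfl, rfl⟩ | ⟨rfl, rfl⟩
      · exact haS (Finset.mem_insert_self _ _)
      · exact hy ha'
    obtain ⟨s, hs, q, hq⟩ := ih hb fun hc => ha'.step hadj hc
    refine ⟨s, hs, Walk.cons hadj q, fun u hu => ?_⟩
    rw [Walk.support_cons, List.mem_cons] at hu ⊢
    exact hu.imp id (hq u)

/-- A common vertex of a path ending in `S₁` and a path ending in `S₂` lies in `S ⊆ S₁ ∩ S₂`, if
`S` separates the starting sets and the paths belong to families with disjoint members. -/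
lemma mem_of_mem_support_of_separates {G : SimpleGraph V} {A B S : Finset V}
    (hS : ∀ b ∈ B, ¬ ReachAvoiding G A S b) {a b s t u : V} (ha : a ∈ A) (hb : b ∈ B)
    {p : G.Walk a s} {q : G.Walk b t} (hp : p.IsPath) (hq : q.IsPath)
    (hps : ∀ v ∈ S, v ∈ p.support → v = s) (hqt : ∀ v ∈ S, v ∈ q.support → v = t)
    (hup : u ∈ p.support) (huq : u ∈ q.support) : u ∈ S := by
  by_contra huS
  -- Each path meets `S` at most in its end, so its piece up to `u ∉ S` avoids `S`; the two pieces
  -- would join `A` to `B`.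
  have key : ∀ {a s : V} {p : G.Walk a s}, p.IsPath → (∀ v ∈ S, v ∈ p.support → v = s) →
      ∀ hup : u ∈ p.support, ∀ v ∈ (p.takeUntil u hup).support, v ∉ S := by
    intro a s p hp hps hup v hv hvS
    obtain rfl := hps v hvS (p.support_takeUntil_subset_support hup hv)
    exact Walk.endpoint_notMem_support_takeUntil hp hup (fun h => huS (h ▸ hvS)) hv
  obtain ⟨b', hb', h⟩ := ReachAvoiding.join (v := u) ⟨a, ha, p.takeUntil u hup, key hp hps hup⟩
    ⟨b, hb, q.takeUntil u huq, key hq hqt huq⟩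
  exact hS b' hb' h

/-- The two families can meet only in `S`, at their ends. The pieces ending at the same vertex of
`S` are joined there, and the two remaining ones through the edge `xy`. -/
lemma Linked.glue {G : SimpleGraph V} {A B S : Finset V} {x y : V} {k : ℕ} (hxy : G.Adj x y)
    (hS : ∀ b ∈ B, ¬ ReachAvoiding (G.deleteEdges {s(x, y)}) A S b) (hxS : x ∉ S) (hyS : y ∉ S)
    (hk : S.card + 1 = k) (hA : Linked (G.deleteEdges {s(x, y)}) A (insert x S) k)
    (hB : Linked (G.deleteEdges {s(x, y)}) B (insert y S) k) : Linked G A B k := by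
  have hle : G.deleteEdges {s(x, y)} ≤ G := deleteEdges_le _
  have hcx : (insert x S).card = k := by rw [Finset.card_insert_of_notMem hxS, hk]
  have hcy : (insert y S).card = k := by rw [Finset.card_insert_of_notMem hyS, hk]
  obtain ⟨U, hU, hUp⟩ := hA.exists_indexed hcx
  obtain ⟨W, hW, hWq⟩ := hB.exists_indexed hcy
  have hUself : ∀ s ∈ insert x S, s ∈ U s := fun s hs => by
    obtain ⟨a, -, p, -, hp⟩ := hUp s hs
    exact (hp s).2 p.end_mem_support
  have hWself : ∀ s ∈ insert y S, s ∈ W s := fun s hs => by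
    obtain ⟨a, -, p, -, hp⟩ := hWq s hs
    exact (hp s).2 p.end_mem_support
  have hUW : ∀ s ∈ insert x S, ∀ t ∈ insert y S, ∀ u, u ∈ U s → u ∈ W t →
      u ∈ S ∧ u = s ∧ u = t := by
    intro s hs t ht u hus hut
    obtain ⟨a, ha, p, hp, hpU⟩ := hUp s hs
    obtain ⟨b, hb, q, hq, hqW⟩ := hWq t ht
    have hu : u ∈ S := mem_of_mem_support_of_separates hS ha hb hp hq
      (fun v hv hvp => hU v (Finset.mem_insert_of_mem hv) s hs v
        (hUself v (Finset.mem_insert_of_mem hv)) ((hpU v).2 hvp))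
      (fun v hv hvq => hW v (Finset.mem_insert_of_mem hv) t ht v
        (hWself v (Finset.mem_insert_of_mem hv)) ((hqW v).2 hvq))
      ((hpU u).1 hus) ((hqW u).1 hut)
    exact ⟨hu, hU u (Finset.mem_insert_of_mem hu) s hs u (hUself u (Finset.mem_insert_of_mem hu)) hus,
      hW u (Finset.mem_insert_of_mem hu) t ht u (hWself u (Finset.mem_insert_of_mem hu)) hut⟩
  let τ : V → V := fun s => if s = x then y else s
  have hτ : ∀ s ∈ insert x S, τ s ∈ insert y S := by
    intro s hs
    by_cases hsx : s = x
    · simp [τ, hsx]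
    · simpa [τ, hsx] using Or.inr (Finset.mem_of_mem_insert_of_ne hs hsx)
  have hτS : ∀ s ∈ insert x S, τ s ∈ S → τ s = s := by
    intro s hs hsS
    by_cases hsx : s = x
    · exact absurd (by simpa [τ, hsx] using hsS) hyS
    · simp [τ, hsx]
  have hτinj : ∀ s ∈ insert x S, ∀ t ∈ insert x S, τ s = τ t → s = t := by
    intro s hs t ht hst
    by_cases hsS : τ s ∈ S
    · rw [← hτS s hs hsS, hst, hτS t ht (hst ▸ hsS)]
    · have : ∀ s ∈ insert x S, τ s ∉ S → s = x := fun s hs hsS => by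
        by_contra hsx
        exact hsS (by simpa [τ, hsx] using Finset.mem_of_mem_insert_of_ne hs hsx)
      rw [this s hs hsS, this t ht (hst ▸ hsS)]
  let ε := (Finset.equivFinOfCardEq hcx).symm
  refine ⟨fun i => U (ε i) ∪ W (τ (ε i)), fun i j hij => ?_, fun i => ?_⟩
  · have hi := (ε i).2
    have hj := (ε j).2
    have hne : (ε i : V) ≠ ε j := fun h => hij (ε.injective (Subtype.ext h))
    have hcr : ∀ s ∈ insert x S, ∀ t ∈ insert x S, ∀ u, u ∈ U s → u ∈ W (τ t) → s = t := by
      intro s hs t ht u hus hut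
      obtain ⟨hu, h1, h2⟩ := hUW s hs _ (hτ t ht) u hus hut
      rw [← h1, h2, hτS t ht (h2 ▸ hu)]
    rw [Set.disjoint_left]
    rintro u (hu | hu) (hu' | hu')
    · exact hne (hU _ hi _ hj u hu hu')
    · exact hne (hcr _ hi _ hj u hu hu')
    · exact hne (hcr _ hj _ hi u hu' hu).symm
    · exact hne (hτinj _ hi _ hj (hW _ (hτ _ hi) _ (hτ _ hj) u hu hu'))
  · suffices H : ∀ s ∈ insert x S, ∃ a ∈ A, ∃ b ∈ B, ∃ p : G.Walk a b,
        ∀ u ∈ p.support, u ∈ U s ∪ W (τ s) from H _ (ε i).2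
    intro s hs
    obtain ⟨a, ha, p, hp, hpU⟩ := hUp s hs
    obtain ⟨b, hb, q, hq, hqW⟩ := hWq (τ s) (hτ s hs)
    have hwalk : ∃ c : G.Walk s (τ s), ∀ u ∈ c.support, u = s ∨ u = τ s := by
      by_cases hsx : s = x
      · have hy' : τ s = y := by simp [τ, hsx]
        rw [hy', hsx]
        exact ⟨hxy.toWalk, by simp⟩
      · have hs' : τ s = s := by simp [τ, hsx]
        rw [hs']
        exact ⟨Walk.nil, by simp⟩
    obtain ⟨c, hc⟩ := hwalk
    refine ⟨a, ha, b, hb, (p.mapLe hle).append (c.append (q.mapLe hle).reverse), fun u hu => ?_⟩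
    rw [Walk.mem_support_append_iff, Walk.mem_support_append_iff, Walk.support_reverse,
      List.mem_reverse, Walk.support_mapLe_eq_support, Walk.support_mapLe_eq_support] at hu
    rcases hu with hu | hu | hu
    · exact Or.inl ((hpU u).2 hu)
    · rcases hc u hu with rfl | rfl
      · exact Or.inl (hUself _ hs)
      · exact Or.inr (hWself _ (hτ _ hs))
    · exact Or.inr ((hqW u).2 hu)

/-- **Menger's theorem** for two sets of vertices of a finite graph. -/
theorem linked_of_forall_exists_walk [Finite V] (k : ℕ) (G : SimpleGraph V) :
    ∀ A B : Finset V, (∀ T : Finset V, T.card < k → ∃ b ∈ B, ReachAvoiding G A T b) →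
      Linked G A B k := by
  induction G using WellFoundedLT.induction with
  | ind G ih =>
    intro A B hG
    by_cases hbot : ∃ x y, G.Adj x y
    swap
    · push Not at hbot
      have hcard : k ≤ (A ∩ B).card := by
        by_contra! hlt
        obtain ⟨b, hb, a, ha, p, hp⟩ := hG _ hlt
        cases p with
        | nil => exact hp b (by simp) (Finset.mem_inter.2 ⟨ha, hb⟩)
        | cons hadj _ => exact hbot _ _ hadj
      obtain ⟨D, hD, hDk⟩ := Finset.exists_subset_card_eq hcard
      let ε := (Finset.equivFinOfCardEq hDk).symm
      refine ⟨fun i => {(ε i : V)}, fun i j hij => ?_, fun i => ?_⟩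
      · rw [Set.disjoint_singleton]
        exact fun h => hij (ε.injective (Subtype.ext h))
      · have := Finset.mem_inter.1 (hD (ε i).2)
        exact ⟨_, this.1, _, this.2, Walk.nil, by simp⟩
    obtain ⟨x₀, y₀, hxy₀⟩ := hbot
    have hlt : G.deleteEdges {s(x₀, y₀)} < G := by
      refine lt_of_le_of_ne (deleteEdges_le _) fun he => ?_
      have h2 := hxy₀
      rw [← he, deleteEdges_adj] at h2
      exact h2.2 rfl
    by_cases hsep : ∀ T : Finset V, T.card < k →
        ∃ b ∈ B, ReachAvoiding (G.deleteEdges {s(x₀, y₀)}) A T b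
    · exact (ih _ hlt A B hsep).mono hlt.le
    push Not at hsep
    obtain ⟨S, hSk, hS⟩ := hsep
    -- A walk of `G` avoiding `S` must leave the side of `A` across the deleted edge, which orients
    -- that edge.
    obtain ⟨x, y, hxy, he, hx, hy, hyS⟩ : ∃ x y, G.Adj x y ∧ s(x, y) = s(x₀, y₀) ∧
        ReachAvoiding (G.deleteEdges {s(x₀, y₀)}) A S x ∧
        ¬ ReachAvoiding (G.deleteEdges {s(x₀, y₀)}) A S y ∧ y ∉ S := by
      obtain ⟨b, hb, a, ha, p, hp⟩ := hG S hSk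
      obtain ⟨d, hd, hd1, hd2⟩ := p.exists_boundary_dart
        {v | ReachAvoiding (G.deleteEdges {s(x₀, y₀)}) A S v}
        ⟨a, ha, Walk.nil, by simpa using hp a p.start_mem_support⟩ (hS b hb)
      have hdS := hp _ (p.dart_snd_mem_support_of_mem_darts hd)
      refine ⟨d.fst, d.snd, d.adj, ?_, hd1, hd2, hdS⟩
      by_contra hne
      exact hd2 (ReachAvoiding.step hd1 (by rw [deleteEdges_adj]; exact ⟨d.adj, hne⟩) hdS)
    rw [← he] at hS hx hy hlt
    have hxS : x ∉ S := by
      obtain ⟨a, -, p, hp⟩ := hx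
      exact hp x p.end_mem_support
    have hSB : ∀ a ∈ A, ¬ ReachAvoiding (G.deleteEdges {s(x, y)}) B S a := by
      rintro a ha ⟨b, hb, p, hp⟩
      exact hS b hb ⟨a, ha, p.reverse, by simpa using hp⟩
    have hxB : ¬ ReachAvoiding (G.deleteEdges {s(x, y)}) B S x := fun h => by
      obtain ⟨b, hb, h'⟩ := hx.join h
      exact hS b hb h'
    -- A walk from `A` to `B` avoiding `T` contains an initial walk to `S ∪ {x}` in the graph
    -- without the edge, so the induction hypothesis applies there.
    have hA : ∀ T : Finset V, T.card < k →
        ∃ s ∈ insert x S, ReachAvoiding (G.deleteEdges {s(x, y)}) A T s := by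
      intro T hT
      obtain ⟨b, hb, a, ha, p, hp⟩ := hG T hT
      obtain ⟨s, hs, q, hq⟩ := exists_walk_to_separator hS hy p hb
        fun haS => ⟨a, ha, Walk.nil, by simpa using haS⟩
      exact ⟨s, hs, a, ha, q, fun u hu => hp u (hq u hu)⟩
    have hB : ∀ T : Finset V, T.card < k →
        ∃ s ∈ insert y S, ReachAvoiding (G.deleteEdges {s(x, y)}) B T s := by
      intro T hT
      obtain ⟨b, hb, a, ha, p, hp⟩ := hG T hT
      rw [Sym2.eq_swap] at hSB hxB ⊢
      obtain ⟨s, hs, q, hq⟩ := exists_walk_to_separator hSB hxB p.reverse ha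
        fun hbS => ⟨b, hb, Walk.nil, by simpa using hbS⟩
      exact ⟨s, hs, b, hb, q, fun u hu => hp u (by simpa using hq u hu)⟩
    refine Linked.glue hxy hS hxS hyS ?_ (ih _ hlt A _ hA) (ih _ hlt B _ hB)
    -- If `|S| + 1 < k`, then `S ∪ {x}` would itself be an admissible `T`, and no walk ending in it
    -- avoids it.
    by_contra hne
    obtain ⟨s, hs, a, -, p, hp⟩ := hA (insert x S)
      (by rw [Finset.card_insert_of_notMem hxS]; omega)
    exact hp s p.end_mem_support hs

end Menger

/-! ### Menger's theorem for two nonadjacent vertices. -/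

section Walks

open SimpleGraph

variable {V : Type*}

/-- A walk whose vertices lie in `R` is a walk of any graph that has all edges inside `R`. -/
lemma exists_walk_of_support_subset {G H : SimpleGraph V} {R : Set V}
    (hGH : ∀ a b, a ∈ R → b ∈ R → G.Adj a b → H.Adj a b) {a b : V} (p : G.Walk a b)
    (hp : ∀ u ∈ p.support, u ∈ R) : ∃ q : H.Walk a b, q.support = p.support := by
  refine ⟨p.transfer H fun e he => ?_, Walk.support_transfer _ _⟩
  induction e using Sym2.ind with
  | h x y =>
    exact hGH x y (hp x (p.fst_mem_support_of_mem_edges he))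
      (hp y (p.snd_mem_support_of_mem_edges he)) (p.adj_of_mem_edges he)

lemma support_subset_of_adj {H : SimpleGraph V} {R : Set V} (hH : ∀ a b, H.Adj a b → b ∈ R)
    {a b : V} (p : H.Walk a b) (ha : a ∈ R) : ∀ u ∈ p.support, u ∈ R := by
  induction p with
  | nil => simpa using ha
  | cons h p ih =>
    intro u hu
    rw [Walk.support_cons, List.mem_cons] at hu
    rcases hu with rfl | hu
    exacts [ha, ih (hH _ _ h) u hu]

lemma eq_of_snd_eq_end {G : SimpleGraph V} {v w : V} (hvw : v ≠ w) {p q : G.Walk v w}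
    (hp : p.IsPath) (hq : q.IsPath) (hpw : p.snd = w) (hqw : q.snd = w) : p = q := by
  have key : ∀ {p : G.Walk v w}, p.IsPath → p.snd = w → ∃ h : G.Adj v w, p = Walk.cons h Walk.nil := by
    intro p hp hpw
    cases p with
    | nil => exact absurd rfl hvw
    | cons h p =>
      rw [Walk.snd_cons] at hpw
      subst hpw
      rw [Walk.cons_isPath_iff, Walk.isPath_iff_nil, ← Walk.eq_nil_iff_nil] at hp
      exact ⟨h, by rw [hp.1]⟩
  obtain ⟨_, rfl⟩ := key hp hpw
  obtain ⟨_, rfl⟩ := key hq hqw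
  rfl

/-- **Menger's theorem** for two nonadjacent vertices `v`, `w` and a set `R` of admissible
vertices. -/
theorem exists_disjoint_paths [Finite V] {G : SimpleGraph V} {v w : V} (hvw : v ≠ w)
    (hadj : ¬ G.Adj v w) {R : Set V} (k : ℕ)
    (hG : ∀ T : Finset V, T.card < k → v ∉ T → w ∉ T →
      ∃ p : G.Walk v w, ∀ u ∈ p.support, u ∈ R ∧ u ∉ T) :
    ∃ P : Fin k → G.Path v w, Function.Injective P ∧
      (∀ i, ∀ u ∈ (P i).1.support, u = v ∨ u = w ∨ u ∈ R) ∧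
      ∀ i j, i ≠ j → ∀ u, u ∈ (P i).1.support → u ∈ (P j).1.support → u = v ∨ u = w := by
  classical
  have := Fintype.ofFinite V
  let R' : Set V := {u | u ∈ R ∧ u ≠ v ∧ u ≠ w}
  let H : SimpleGraph V :=
    { Adj := fun a b => G.Adj a b ∧ a ∈ R' ∧ b ∈ R'
      symm := ⟨fun a b h => ⟨h.1.symm, h.2.2, h.2.1⟩⟩
      loopless := ⟨fun a h => h.1.ne rfl⟩ }
  have hHG : H ≤ G := fun a b h => h.1
  have hlink : Linked H (Finset.univ.filter fun u => G.Adj v u ∧ u ∈ R')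
      (Finset.univ.filter fun u => G.Adj u w ∧ u ∈ R') k := by
    refine linked_of_forall_exists_walk k H _ _ fun T hT => ?_
    obtain ⟨p, hp⟩ := hG ((T.erase v).erase w)
      (lt_of_le_of_lt (Finset.card_le_card ((Finset.erase_subset _ _).trans
        (Finset.erase_subset _ _))) hT) (by simp) (by simp)
    have hpath := p.bypass_isPath
    have hsupp : ∀ u ∈ p.bypass.support, u ∈ R ∧ u ∉ (T.erase v).erase w := fun u hu =>
      hp u (p.support_bypass_subset_support hu)
    generalize p.bypass = p' at hpath hsupp
    cases p' with
    | nil => exact absurd rfl hvw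
    | @cons _ a _ hva q =>
      rw [Walk.cons_isPath_iff] at hpath
      have hq := hpath.1.reverse
      have hqs : ∀ u ∈ q.reverse.support, u ∈ R ∧ u ∉ (T.erase v).erase w ∧ u ≠ v := by
        intro u hu
        rw [Walk.support_reverse, List.mem_reverse] at hu
        have := hsupp u (by rw [Walk.support_cons]; exact List.mem_cons_of_mem _ hu)
        exact ⟨this.1, this.2, fun h => hpath.2 (h ▸ hu)⟩
      generalize q.reverse = q' at hq hqs
      cases q' with
      | nil => exact absurd hva hadj
      | @cons _ c _ hwc s =>
        rw [Walk.cons_isPath_iff] at hq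
        have hs : ∀ u ∈ s.reverse.support, u ∈ R' ∧ u ∉ T := by
          intro u hu
          rw [Walk.support_reverse, List.mem_reverse] at hu
          have h1 := hqs u (by rw [Walk.support_cons]; exact List.mem_cons_of_mem _ hu)
          have h2 : u ≠ w := fun h => hq.2 (h ▸ hu)
          refine ⟨⟨h1.1, h1.2.2, h2⟩, fun hT => h1.2.1 ?_⟩
          simp [h2, h1.2.2, hT]
        obtain ⟨t, ht⟩ := exists_walk_of_support_subset (H := H) (R := R')
          (fun a b ha hb hab => ⟨hab, ha, hb⟩) s.reverse fun u hu => (hs u hu).1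
        rw [← ht] at hs
        refine ⟨c, ?_, a, ?_, t, fun u hu => (hs u hu).2⟩
        · simpa using ⟨hwc.symm, (hs c t.end_mem_support).1⟩
        · simpa using ⟨hva, (hs a t.start_mem_support).1⟩
  obtain ⟨U, hU, hp⟩ := hlink
  choose a ha b hb p hp using hp
  simp only [Finset.mem_filter, Finset.mem_univ, true_and] at ha hb
  have hR' : ∀ i, ∀ u ∈ ((p i).mapLe hHG).bypass.support, u ∈ R' ∧ u ∈ U i := by
    intro i u hu
    have hu' := Walk.support_bypass_subset_support _ hu
    rw [Walk.support_mapLe_eq_support] at hu'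
    exact ⟨support_subset_of_adj (fun a b (h : H.Adj a b) => h.2.2) (p i) (ha i).2 u hu', hp i u hu'⟩
  have hpath : ∀ i, (Walk.cons (ha i).1
      (((p i).mapLe hHG).bypass.concat (hb i).1)).IsPath := by
    intro i
    rw [Walk.cons_isPath_iff]
    refine ⟨Walk.IsPath.concat (Walk.bypass_isPath _) (fun hw => (hR' i w hw).1.2.2 rfl) _, ?_⟩
    rw [Walk.support_concat, List.mem_append, List.mem_singleton]
    rintro (h | h)
    exacts [(hR' i v h).1.2.1 rfl, hvw h]
  have hmem : ∀ i, ∀ u ∈ (Walk.cons (ha i).1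
      (((p i).mapLe hHG).bypass.concat (hb i).1)).support,
      u = v ∨ u = w ∨ (u ∈ R ∧ u ∈ U i) := by
    intro i u hu
    rw [Walk.support_cons, List.mem_cons, Walk.support_concat, List.mem_append,
      List.mem_singleton] at hu
    rcases hu with hu | hu | hu
    · exact Or.inl hu
    · exact Or.inr (Or.inr ⟨(hR' i u hu).1.1, (hR' i u hu).2⟩)
    · exact Or.inr (Or.inl hu)
  have hdisj : ∀ i j, i ≠ j → ∀ u, u ∈ (Walk.cons (ha i).1
      (((p i).mapLe hHG).bypass.concat (hb i).1)).support → u ∈ (Walk.cons (ha j).1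
      (((p j).mapLe hHG).bypass.concat (hb j).1)).support → u = v ∨ u = w := by
    intro i j hij u hi hj
    rcases hmem i u hi with h | h | h
    · exact Or.inl h
    · exact Or.inr h
    rcases hmem j u hj with h' | h' | h'
    · exact Or.inl h'
    · exact Or.inr h'
    exact absurd h'.2 (Set.disjoint_left.1 (hU i j hij) h.2)
  refine ⟨fun i => ⟨_, hpath i⟩, fun i j hij => ?_, fun i u hu => ?_, hdisj⟩
  · by_contra hne
    have hai : a i ∈ (Walk.cons (ha i).1
        (((p i).mapLe hHG).bypass.concat (hb i).1)).support := by simp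
    have hP := Subtype.ext_iff.1 hij
    simp only at hP
    rcases hdisj i j hne (a i) hai (by rw [← hP]; exact hai) with h | h
    · exact (ha i).2.2.1 h
    · exact (ha i).2.2.2 h
  · rcases hmem i u hu with h | h | h
    exacts [Or.inl h, Or.inr (Or.inl h), Or.inr (Or.inr h.1)]

end Walks

/-! ### Crabbed paths in sign labelings. -/

section Labelings

open SimpleGraph

variable {E V : Type*} [Fintype E]

lemma crabbed_at_iff [DecidableEq E] {X Y U : SignVec E} :
    (posPart U ⊆ posPart X ∪ posPart Y ∧ negPart U ⊆ negPart X ∪ negPart Y) ↔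
      ∀ e, U e = 0 ∨ U e = X e ∨ U e = Y e := by
  simp only [Finset.subset_iff, posPart, negPart, Finset.mem_union, Finset.mem_filter,
    Finset.mem_univ, true_and, ← forall_and]
  refine forall_congr' fun e => ?_
  generalize U e = u
  generalize X e = x
  generalize Y e = y
  revert u x y
  decide

variable [DecidableEq E]

lemma crabbedFor_iff {G : SimpleGraph V} {L : V → SignVec E} {X Y : SignVec E} {v w : V}
    {p : G.Walk v w} :
    CrabbedFor L X Y p ↔ ∀ u ∈ p.support, ∀ e, L u e = 0 ∨ L u e = X e ∨ L u e = Y e := by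
  refine forall₂_congr fun u _ => ?_
  rw [← crabbed_at_iff]

namespace IsUniformOM

variable {r : ℕ} {C : Set (SignVec E)}

/-- A neighbour of `X` is determined by the element at which it leaves the zero support of `X` and
its sign there. -/
lemma neighbor_unique (h : IsUniformOM r C) {X U W : SignVec E} (hX : X ∈ C) (hU : U ∈ C)
    (hW : W ∈ C) {a b b' : E} (hXb : X b ≠ 0) (hXb' : X b' ≠ 0) (ha : X a = 0)
    (hU0 : zeroSupp U = insert b ((zeroSupp X).erase a))
    (hW0 : zeroSupp W = insert b' ((zeroSupp X).erase a)) (hXU : ∀ e, CompatAt X U e)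
    (hXW : ∀ e, CompatAt X W e) (hUW : U a = W a) : U = W := by
  have hab : a ≠ b := fun h => hXb (h ▸ ha)
  have hUa : U a ≠ 0 := by rw [Ne, ← mem_zeroSupp, hU0]; simp [hab]
  have hUb : U b = 0 := by rw [← mem_zeroSupp, hU0]; simp
  have hWb' : W b' = 0 := by rw [← mem_zeroSupp, hW0]; simp
  by_cases hbb : b = b'
  · subst hbb
    rcases eq_or_eq_neg_of_axiomC2 h.c1 h.c2 hU hW (hU0.trans hW0.symm) with h' | h'
    · exact h'.symm
    · rw [h', Pi.neg_apply] at hUW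
      exact absurd hUW (sign_ne_neg_self hUa)
  exfalso
  have hWb : W b = X b := by
    have hne : W b ≠ 0 := by rw [Ne, ← mem_zeroSupp, hW0]; simp [hbb, hXb]
    rcases hXW b with h' | h' | h'
    exacts [absurd h' hXb, absurd h' hne, h'.symm]
  have hUb' : U b' = X b' := by
    have hne : U b' ≠ 0 := by rw [Ne, ← mem_zeroSupp, hU0]; simp [Ne.symm hbb, hXb']
    rcases hXU b' with h' | h' | h'
    exacts [absurd h' hXb', absurd h' hne, h'.symm]
  -- With `b ≠ b'`, the eliminated vector vanishes on `X⁰` and so is `X` or `-X`. Its value at `b`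
  -- is `0` or `-X b`, at `b'` it is `0` or `X b'`: both cases fail.
  obtain ⟨Z, hZ, hZa, hZf⟩ := h.elim hU (h.neg_mem hW) (e := a)
    (fun hn => by rw [neg_neg] at hn; exact hXb (by rw [← hWb, ← hn, hUb]))
    (fun hc => by
      rw [CompatAt, Pi.neg_apply, ← hUW] at hc
      rcases hc with hc | hc | hc
      exacts [hUa hc, hUa ((by decide : ∀ t : SignType, -t = 0 → t = 0) _ hc),
        sign_ne_neg_self hUa hc])
  have hXZ : zeroSupp X ⊆ zeroSupp Z := by
    intro x hx
    rw [mem_zeroSupp]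
    by_cases hxa : x = a
    · rw [hxa, hZa]
    have hxU : U x = 0 := by
      rw [← mem_zeroSupp, hU0]; exact Finset.mem_insert_of_mem (Finset.mem_erase.2 ⟨hxa, hx⟩)
    have hxW : W x = 0 := by
      rw [← mem_zeroSupp, hW0]; exact Finset.mem_insert_of_mem (Finset.mem_erase.2 ⟨hxa, hx⟩)
    simpa [hxU, hxW] using hZf x
  have h1 := hZf b
  have h2 := hZf b'
  rw [Pi.neg_apply, hUb, hWb] at h1
  rw [Pi.neg_apply, hUb', hWb'] at h2
  rcases h.eq_or_eq_neg_of_subset hX hZ hXZ with rfl | rfl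
  · revert h1 hXb
    generalize Z b = t
    revert t; decide
  · rw [Pi.neg_apply] at h2
    revert h2 hXb'
    generalize X b' = t
    revert t; decide

end IsUniformOM

namespace IsSignLabeling

variable {G : SimpleGraph V} {r : ℕ} {L : V → SignVec E}

lemma adj_iff_adjOn (hL : IsSignLabeling G r L) {v w : V} :
    G.Adj v w ↔ AdjOn Finset.univ (L v) (L w) := by
  rw [hL.adj_iff, separator_eq_empty_iff, AdjOn]
  simp

lemma card_zeroSupp (hL : IsSignLabeling G r L) (v : V) : (zeroSupp (L v)).card + 1 = r :=
  card_zeroSupp_of_axiomC1 hL.c1 ⟨v, rfl⟩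

/-- If crabbed paths exist, then the labels satisfy cocircuit elimination. -/
lemma axiomC3_of_exists_crabbed (hL : IsSignLabeling G r L)
    (h : ∀ v w : V, zeroSupp (L v) ≠ zeroSupp (L w) → ∃ p : G.Path v w, Crabbed L p) :
    AxiomC3 (Set.range L) := by
  rintro _ ⟨v, rfl⟩ _ ⟨w, rfl⟩ hne e he
  have he' := mem_separator_iff.1 he
  have hvw : zeroSupp (L v) ≠ zeroSupp (L w) := by
    intro h0
    rcases eq_or_eq_neg_of_axiomC2 hL.c1 hL.c2 ⟨v, rfl⟩ ⟨w, rfl⟩ h0 with h' | h'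
    · exact he' (Or.inr (Or.inr (congrFun h' e).symm))
    · exact hne (by rw [h', neg_neg])
  obtain ⟨p, hp⟩ := h v w hvw
  have hp' := crabbedFor_iff.1 hp
  obtain ⟨d, hd, hd1, hd2⟩ := p.1.exists_boundary_dart {u | L u e = L v e} rfl
    (fun h' => he' (Or.inr (Or.inr (Eq.symm h'))))
  have hc := (hL.adj_iff_adjOn.1 d.adj).2 e (Finset.mem_univ e)
  have hmem := p.1.dart_snd_mem_support_of_mem_darts hd
  simp only [Set.mem_ofPred_eq] at hd1 hd2
  refine ⟨_, ⟨d.snd, rfl⟩, ?_, fun f _ => ?_⟩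
  · rcases hc with hc | hc | hc
    · exact absurd (Or.inl (hd1 ▸ hc)) he'
    · exact hc
    · exact absurd (hc.symm.trans hd1) hd2
  · rcases hp' _ hmem f with h' | h' | h'
    exacts [Or.inr (Or.inr h'), Or.inl h', Or.inr (Or.inl h')]

/-- Each path is charged to the zero of `L v` that its first step frees; crabbedness gives it the
nonzero sign of `L w` there. -/
lemma card_le_of_hasDisjointCrabbedPaths (hL : IsSignLabeling G r L)
    (hC : IsUniformOM r (Set.range L)) {v w : V} (hvw : v ≠ w) {k : ℕ}
    (hk : HasDisjointCrabbedPaths G L v w k) :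
    k ≤ (zeroSupp (L v) \ zeroSupp (L w)).card := by
  obtain ⟨P, hinj, hcr, hdisj⟩ := hk
  have hnil : ∀ i, ¬ (P i).1.Nil := fun i => Walk.not_nil_of_ne hvw
  have hstep : ∀ i, ∃ a b, L v a = 0 ∧ L w a ≠ 0 ∧ L v b ≠ 0 ∧
      zeroSupp (L (P i).1.snd) = insert b ((zeroSupp (L v)).erase a) ∧
      L (P i).1.snd a = L w a := by
    intro i
    have hc1 := hL.card_zeroSupp v
    have hc2 := hL.card_zeroSupp (P i).1.snd
    obtain ⟨a, ha, ha', b, -, hb, hab⟩ := exists_exchange_of_card_symmDiff (by omega)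
      (hL.adj_iff_adjOn.1 ((P i).1.adj_snd (hnil i))).1
    rw [mem_zeroSupp] at ha ha' hb
    have hcr := crabbedFor_iff.1 (hcr i) (P i).1.snd (Walk.getVert_mem_support _ _) a
    rw [ha] at hcr
    have hw : L (P i).1.snd a = L w a := by tauto
    exact ⟨a, b, ha, by rwa [← hw], hb, hab, hw⟩
  choose a b ha haw hb hab hs using hstep
  have hainj : Function.Injective a := by
    intro i j hij
    by_contra hne
    have hsnd : (P i).1.snd = (P j).1.snd := by
      refine hL.injective (hC.neighbor_unique ⟨v, rfl⟩ ⟨_, rfl⟩ ⟨_, rfl⟩ (hb i) (hb j) (ha i)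
        (hab i) (by rw [hij]; exact hab j)
        (fun e => (hL.adj_iff_adjOn.1 ((P i).1.adj_snd (hnil i))).2 e (Finset.mem_univ e))
        (fun e => (hL.adj_iff_adjOn.1 ((P j).1.adj_snd (hnil j))).2 e (Finset.mem_univ e)) ?_)
      rw [hs i, hij, hs j]
    -- A shared second vertex can only be `w`, and then both paths are the single edge, against
    -- distinctness.
    rcases hdisj i j hne _ (Walk.getVert_mem_support _ 1)
      (by rw [show (P i).1.getVert 1 = (P j).1.snd from hsnd]; exact Walk.getVert_mem_support _ _)
      with h | h
    · exact ((P i).1.adj_snd (hnil i)).ne h.symm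
    · exact hne (hinj (Subtype.ext (eq_of_snd_eq_end hvw (P i).2 (P j).2 h (hsnd ▸ h))))
  have := Finset.card_le_card_of_injOn (s := Finset.univ) (t := zeroSupp (L v) \ zeroSupp (L w)) a
    (fun i _ => by simp [ha i, haw i]) hainj.injOn
  simpa using this

lemma exists_walk_of_reach (hL : IsSignLabeling G r L) {P : SignVec E → Prop}
    (hP : ∀ U, P U → U ∈ Set.range L) {v : V} (hv : P (L v)) {Y : SignVec E}
    (h : Reach Finset.univ P (L v) Y) :
    ∀ w, L w = Y → ∃ p : G.Walk v w, ∀ u ∈ p.support, P (L u) := by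
  induction h with
  | refl =>
    intro w hw
    obtain rfl := hL.injective hw
    exact ⟨Walk.nil, by simpa using hv⟩
  | tail _ hs ih =>
    rintro w rfl
    obtain ⟨hU, hW, hadj⟩ := hs
    obtain ⟨u, rfl⟩ := hP _ hU
    obtain ⟨p, hp⟩ := ih u rfl
    refine ⟨p.concat (hL.adj_iff_adjOn.2 hadj), fun x hx => ?_⟩
    rw [Walk.support_concat, List.mem_append, List.mem_singleton] at hx
    rcases hx with hx | rfl
    exacts [hp x hx, hW]

lemma hasDisjointCrabbedPaths (hL : IsSignLabeling G r L) (hC : IsUniformOM r (Set.range L))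
    {v w : V} (hvw : v ≠ w) :
    HasDisjointCrabbedPaths G L v w (zeroSupp (L v) \ zeroSupp (L w)).card := by
  classical
  have : Finite V := Finite.of_injective L hL.injective
  generalize hk : (zeroSupp (L v) \ zeroSupp (L w)).card = k
  let A := zeroSupp (L v) ∩ zeroSupp (L w)
  let K : E → Set SignType := fun e => {0, L v e, L w e}
  have hcv := hL.card_zeroSupp v
  have hcw := hL.card_zeroSupp w
  have hA : A.card + k + 1 = r := by
    have hAc : A.card = (zeroSupp (L v) ∩ zeroSupp (L w)).card := rfl
    have := Finset.card_sdiff_add_card_inter (zeroSupp (L v)) (zeroSupp (L w))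
    omega
  have hv : InRegion (Set.range L) A K (L v) :=
    ⟨⟨v, rfl⟩, fun e he => mem_zeroSupp.1 (Finset.mem_inter.1 he).1, fun e => Or.inr (Or.inl rfl)⟩
  have hw : InRegion (Set.range L) A K (L w) :=
    ⟨⟨w, rfl⟩, fun e he => mem_zeroSupp.1 (Finset.mem_inter.1 he).2, fun e => Or.inr (Or.inr rfl)⟩
  have hK : ∀ e ∉ A, ∃ s ∈ K e, s ≠ 0 := by
    intro e he
    simp only [A, Finset.mem_inter, mem_zeroSupp, not_and_or] at he
    rcases he with he | he
    exacts [⟨_, Or.inr (Or.inl rfl), he⟩, ⟨_, Or.inr (Or.inr rfl), he⟩]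
  have hwalk : ∀ T : Finset V, T.card < k → v ∉ T → w ∉ T → ∃ p : G.Walk v w,
      ∀ u ∈ p.support, (∀ e, L u e = 0 ∨ L u e = L v e ∨ L u e = L w e) ∧ u ∉ T := by
    intro T hT hvT hwT
    have hnot : ∀ u ∉ T, L u ∉ T.image L := fun u hu h => by
      obtain ⟨x, hx, hxu⟩ := Finset.mem_image.1 h
      exact hu (hL.injective hxu ▸ hx)
    have hreach := hC.reach_region (K := K) (fun e => Or.inl rfl) k A hK hA (T.image L)
      (lt_of_le_of_lt Finset.card_image_le hT) (L v) (L w) hv (hnot v hvT) hw (hnot w hwT)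
    obtain ⟨p, hp⟩ := hL.exists_walk_of_reach (fun U hU => hU.1.1) ⟨hv, hnot v hvT⟩ hreach w rfl
    exact ⟨p, fun u hu => ⟨(hp u hu).1.2.2, fun h => (hp u hu).2 (Finset.mem_image_of_mem L h)⟩⟩
  -- Menger's theorem for two vertices needs nonadjacency; adjacent vertices have `k = 1`, where a
  -- single crabbed path suffices.
  by_cases hadj : G.Adj v w
  · have hk1 : k = 1 := by
      obtain ⟨a, ha, haw, b, -, hb, hab⟩ := exists_exchange_of_card_symmDiff (by omega)
        (hL.adj_iff_adjOn.1 hadj).1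
      have : zeroSupp (L v) \ zeroSupp (L w) = {a} := by
        ext x
        rw [Finset.mem_sdiff, Finset.mem_singleton]
        refine ⟨fun hx => ?_, fun hx => hx ▸ ⟨ha, haw⟩⟩
        by_contra hxa
        exact hx.2 (by rw [hab]; simp [hxa, mem_zeroSupp.1 hx.1])
      rw [← hk, this, Finset.card_singleton]
    subst hk1
    obtain ⟨p, hp⟩ := hwalk ∅ (by simp) (by simp) (by simp)
    refine ⟨fun _ => p.toPath, Function.injective_of_subsingleton _, fun _ => ?_,
      fun i j hij => absurd (Subsingleton.elim i j) hij⟩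
    exact crabbedFor_iff.2 fun u hu => (hp u (p.support_bypass_subset_support hu)).1
  · obtain ⟨P, hP, hPR, hPd⟩ := exists_disjoint_paths hvw hadj
      (R := {u | ∀ e, L u e = 0 ∨ L u e = L v e ∨ L u e = L w e}) k hwalk
    refine ⟨P, hP, fun i => crabbedFor_iff.2 fun u hu e => ?_, hPd⟩
    rcases hPR i u hu with rfl | rfl | h
    exacts [Or.inr (Or.inl rfl), Or.inr (Or.inr rfl), h e]

end IsSignLabeling

end Labelings

end CocircuitGraph

theorem mainTheorem1 {E V : Type*} [Fintype E] [DecidableEq E] (G : SimpleGraph V) (r : ℕ)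
    (L : V → CocircuitGraph.SignVec E) (hL : CocircuitGraph.IsSignLabeling G r L) :
    List.TFAE [
      CocircuitGraph.IsOMLabeling G r L,
      ∀ v w : V, v ≠ w →
        IsGreatest {k : ℕ | CocircuitGraph.HasDisjointCrabbedPaths G L v w k}
          (CocircuitGraph.zeroSupp (L v) \ CocircuitGraph.zeroSupp (L w)).card,
      ∀ v w : V, CocircuitGraph.zeroSupp (L v) ≠ CocircuitGraph.zeroSupp (L w) →
        ∃ p : G.Path v w, CocircuitGraph.Crabbed L p] := by
  tfae_have 1 → 2 := fun h v w hvw =>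
    ⟨hL.hasDisjointCrabbedPaths h.2 hvw, fun _ hk =>
      hL.card_le_of_hasDisjointCrabbedPaths h.2 hvw hk⟩
  tfae_have 2 → 3 := by
    intro h v w hvw
    obtain ⟨P, -, hP, -⟩ := (h v w fun hne => hvw (hne ▸ rfl)).1
    have hpos : 0 < (CocircuitGraph.zeroSupp (L v) \ CocircuitGraph.zeroSupp (L w)).card := by
      rw [Finset.card_pos, Finset.sdiff_nonempty]
      intro hsub
      have hcv := hL.card_zeroSupp v
      have hcw := hL.card_zeroSupp w
      exact hvw (Finset.eq_of_subset_of_card_le hsub (by omega))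
    exact ⟨P ⟨0, hpos⟩, hP _⟩
  tfae_have 3 → 1 := fun h =>
    ⟨hL, ⟨hL.c1, hL.c2, hL.axiomC3_of_exists_crabbed h⟩⟩
  tfae_finish
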